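/- Let $m\ge 1$ be an integer, let $\Omega\subset\mathbb R$ be one of $\mathbb R$, $(-\infty,L_1)$, $(L_2,\infty)$ with $L_1,L_2\in\mathbb R$, and let $v\in C^m(\overline\Omega;\mathbb R)$ (derivatives being one-sided at a boundary point) satisfy $$|v'(y)|+|v''(y)|+\cdots+|v^{(m)}(y)|>0\quad\text{for all } y\in\overline\Omega,\qquad\text{and}\qquad \liminf_{|y|\to\infty,\ y\in\overline\Omega}|v'(y)|\ge c_0\ \text{ for some } c_0>0.$$ For $\nu>0$ and $k\in\mathbb R\setminus\{0\}$, let $H_{\nu,k}$ be the operator on $X=L^2(\Omega;\mathbb C)$ given by $H_{\nu,k}g=-\nu g''+\mathrm i k\,v\,g$ with homogeneous Neumann boundary conditions; precisely, $H_{\nu,k}$ is the closure of this differential operator on the domain $$\{g\in H^2(\Omega):\ g'=0 \text{ on } \partial\Omega,\ vg\in L^2(\Omega)\}.$$ Define its pseudospectral abscissa by $$\Psi(H_{\nu,k})=\Bigl(\sup_{z\in \mathrm i\mathbb R}\|(H_{\nu,k}-z)^{-1}\|_{X\to X}\Bigr)^{-1},$$ where $\|(H_{\nu,k}-z)^{-1}\|=\infty$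 if $z$ belongs to the spectrum of $H_{\nu,k}$ (and $\infty^{-1}=0$), and set $$\lambda_{\nu,k}=\begin{cases}\nu^{\frac{m}{m+2}}|k|^{\frac{2}{m+2}}, & 0<\nu\le |k|,\\[2pt] \dfrac{k^2}{\nu}, & 0<|k|\le\nu.\end{cases}$$ Then there exists a constant $C>0$, depending only on $m$, $\Omega$ and $v$, such that for all $\nu>0$ and all $k\neq 0$, $$\Psi(H_{\nu,k})\ \ge\ C\,\lambda_{\nu,k}.$$ -/

import Mathlib

open MeasureTheory Filter Set TopologicalSpace
open scoped ENNReal ContDiff Topology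

noncomputable section

namespace ShearFlow

/-- The Hilbert space `X = L²(Ω; ℂ)` for an open set `Ω ⊆ ℝ` with Lebesgue measure. -/
abbrev X (Ω : Opens ℝ) : Type := Lp ℂ 2 (volume.restrict (Ω : Set ℝ))

/-- `g₁ ∈ L²(Ω)` is the weak (distributional) derivative of `g ∈ L²(Ω)` on `Ω`. -/
def IsWeakDeriv (Ω : Opens ℝ) (g g₁ : X Ω) : Prop :=
  ∀ φ : ℝ → ℝ, ContDiff ℝ ∞ φ → HasCompactSupport φ → tsupport φ ⊆ (Ω : Set ℝ) →
    ∫ y in (Ω : Set ℝ), deriv φ y • g y = - ∫ y in (Ω : Set ℝ), φ y • g₁ y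

/-- Vanishing trace on `∂Ω`: `w` has a representative which is continuous on the closure of `Ω`
and is zero at every boundary point. (On an interval, a function of class `H¹` always has a
representative continuous up to the boundary.) -/
def HasZeroTrace (Ω : Opens ℝ) (w : X Ω) : Prop :=
  ∃ u : ℝ → ℂ, ContinuousOn u (closure (Ω : Set ℝ)) ∧
    (∀ᵐ y ∂(volume.restrict (Ω : Set ℝ)), w y = u y) ∧
    ∀ y ∈ frontier (Ω : Set ℝ), u y = 0

lemma integrable_smul_of_test {Ω : Opens ℝ} (g : X Ω) {φ : ℝ → ℝ} (hφ : Continuous φ)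
    (hc : HasCompactSupport φ) :
    Integrable (fun y => φ y • g y) (volume.restrict (Ω : Set ℝ)) := by
  have h1 : MemLp φ 2 (volume.restrict (Ω : Set ℝ)) :=
    (hφ.memLp_of_hasCompactSupport hc (p := 2) (μ := volume)).restrict _
  exact MemLp.integrable_mul (f := fun y => (φ y : ℂ)) (p := 2) (q := 2)
    h1.ofReal (Lp.memLp g) |>.congr (by filter_upwards with y; simp)

lemma IsWeakDeriv.add {Ω : Opens ℝ} {g g₁ h h₁ : X Ω} (hg : IsWeakDeriv Ω g g₁)
    (hh : IsWeakDeriv Ω h h₁) : IsWeakDeriv Ω (g + h) (g₁ + h₁) := by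
  intro φ h1 h2 h3
  have key : ∀ (a b : X Ω) (ψ : ℝ → ℝ), Continuous ψ → HasCompactSupport ψ →
      ∫ y in (Ω : Set ℝ), ψ y • (a + b : X Ω) y
        = (∫ y in (Ω : Set ℝ), ψ y • a y) + ∫ y in (Ω : Set ℝ), ψ y • b y := by
    intro a b ψ hψ hc
    rw [← integral_add (integrable_smul_of_test a hψ hc) (integrable_smul_of_test b hψ hc)]
    refine integral_congr_ae ?_
    filter_upwards [Lp.coeFn_add a b] with y hy
    rw [hy, Pi.add_apply, smul_add]
  rw [key _ _ _ (h1.continuous_deriv (by simp)) h2.deriv, key _ _ _ h1.continuous h2,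
    hg φ h1 h2 h3, hh φ h1 h2 h3]
  ring

lemma IsWeakDeriv.smul {Ω : Opens ℝ} {g g₁ : X Ω} (c : ℂ) (hg : IsWeakDeriv Ω g g₁) :
    IsWeakDeriv Ω (c • g) (c • g₁) := by
  intro φ h1 h2 h3
  have key : ∀ (a : X Ω) (ψ : ℝ → ℝ),
      ∫ y in (Ω : Set ℝ), ψ y • (c • a : X Ω) y = c • ∫ y in (Ω : Set ℝ), ψ y • a y := by
    intro a ψ
    rw [← integral_smul]
    refine integral_congr_ae ?_
    filter_upwards [Lp.coeFn_smul c a] with y hy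
    rw [hy, Pi.smul_apply, smul_comm]
  rw [key, key, hg φ h1 h2 h3, smul_neg]

lemma isWeakDeriv_zero (Ω : Opens ℝ) : IsWeakDeriv Ω 0 0 := by
  intro φ _ _ _
  have key : ∀ ψ : ℝ → ℝ, ∫ y in (Ω : Set ℝ), ψ y • (0 : X Ω) y = 0 := by
    intro ψ
    rw [← integral_zero ℝ ℂ (μ := volume.restrict (Ω : Set ℝ))]
    refine integral_congr_ae ?_
    filter_upwards [Lp.coeFn_zero ℂ 2 (volume.restrict (Ω : Set ℝ))] with y hy
    rw [hy, Pi.zero_apply, smul_zero]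
  rw [key, key, neg_zero]

lemma IsWeakDeriv.unique {Ω : Opens ℝ} {g a b : X Ω} (ha : IsWeakDeriv Ω g a)
    (hb : IsWeakDeriv Ω g b) : a = b := by
  have hlint : LocallyIntegrableOn (a - b : X Ω) (Ω : Set ℝ) volume :=
    locallyIntegrableOn_of_locallyIntegrable_restrict
      ((Lp.memLp (a - b)).locallyIntegrable (by norm_num))
  have h0 := Ω.isOpen.ae_eq_zero_of_integral_contDiff_smul_eq_zero hlint (by
    intro φ h1 h2 h3
    rw [← setIntegral_eq_integral_of_forall_compl_eq_zero (s := (Ω : Set ℝ))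
      (fun y hy => by rw [image_eq_zero_of_notMem_tsupport (fun h => hy (h3 h)), zero_smul])]
    have e : ∫ y in (Ω : Set ℝ), φ y • (a - b : X Ω) y
        = (∫ y in (Ω : Set ℝ), φ y • a y) - ∫ y in (Ω : Set ℝ), φ y • b y := by
      rw [← integral_sub (integrable_smul_of_test a h1.continuous h2)
        (integrable_smul_of_test b h1.continuous h2)]
      refine integral_congr_ae ?_
      filter_upwards [Lp.coeFn_sub a b] with y hy
      rw [hy, Pi.sub_apply, smul_sub]
    have := (ha φ h1 h2 h3).symm.trans (hb φ h1 h2 h3)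
    rw [e, neg_inj.1 this, sub_self])
  refine sub_eq_zero.1 (Lp.ext ?_)
  filter_upwards [(ae_restrict_iff' Ω.isOpen.measurableSet).2 h0,
    Lp.coeFn_zero ℂ 2 (volume.restrict (Ω : Set ℝ))] with y h1 h2
  rw [h1, h2, Pi.zero_apply]

lemma HasZeroTrace.add {Ω : Opens ℝ} {a b : X Ω} (ha : HasZeroTrace Ω a)
    (hb : HasZeroTrace Ω b) : HasZeroTrace Ω (a + b) := by
  obtain ⟨u, hu, hu', hu0⟩ := ha
  obtain ⟨w, hw, hw', hw0⟩ := hb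
  refine ⟨u + w, hu.add hw, ?_, fun y hy => by simp [hu0 y hy, hw0 y hy]⟩
  filter_upwards [Lp.coeFn_add a b, hu', hw'] with y h1 h2 h3
  rw [h1, Pi.add_apply, Pi.add_apply, h2, h3]

lemma HasZeroTrace.smul {Ω : Opens ℝ} {a : X Ω} (c : ℂ) (ha : HasZeroTrace Ω a) :
    HasZeroTrace Ω (c • a) := by
  obtain ⟨u, hu, hu', hu0⟩ := ha
  refine ⟨c • u, hu.const_smul c, ?_, fun y hy => by simp [hu0 y hy]⟩
  filter_upwards [Lp.coeFn_smul c a, hu'] with y h1 h2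
  rw [h1, Pi.smul_apply, Pi.smul_apply, h2]

lemma hasZeroTrace_zero (Ω : Opens ℝ) : HasZeroTrace Ω 0 := by
  refine ⟨0, continuousOn_const, ?_, fun y _ => rfl⟩
  filter_upwards [Lp.coeFn_zero ℂ 2 (volume.restrict (Ω : Set ℝ))] with y hy
  rw [hy]

/-- `g` belongs to `H²(Ω)` and satisfies the homogeneous Neumann condition, with second weak
derivative `g₂`. -/
def IsNeumannSecondDeriv (Ω : Opens ℝ) (g g₂ : X Ω) : Prop :=
  ∃ g₁ : X Ω, IsWeakDeriv Ω g g₁ ∧ HasZeroTrace Ω g₁ ∧ IsWeakDeriv Ω g₁ g₂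

lemma IsNeumannSecondDeriv.add {Ω : Opens ℝ} {g g₂ h h₂ : X Ω}
    (hg : IsNeumannSecondDeriv Ω g g₂) (hh : IsNeumannSecondDeriv Ω h h₂) :
    IsNeumannSecondDeriv Ω (g + h) (g₂ + h₂) := by
  obtain ⟨a, a1, a2, a3⟩ := hg
  obtain ⟨b, b1, b2, b3⟩ := hh
  exact ⟨a + b, a1.add b1, a2.add b2, a3.add b3⟩

lemma IsNeumannSecondDeriv.smul {Ω : Opens ℝ} {g g₂ : X Ω} (c : ℂ)
    (hg : IsNeumannSecondDeriv Ω g g₂) : IsNeumannSecondDeriv Ω (c • g) (c • g₂) := by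
  obtain ⟨a, a1, a2, a3⟩ := hg
  exact ⟨c • a, a1.smul c, a2.smul c, a3.smul c⟩

lemma IsNeumannSecondDeriv.unique {Ω : Opens ℝ} {g a b : X Ω}
    (ha : IsNeumannSecondDeriv Ω g a) (hb : IsNeumannSecondDeriv Ω g b) : a = b := by
  obtain ⟨p, p1, _, p3⟩ := ha
  obtain ⟨q, q1, _, q3⟩ := hb
  obtain rfl := p1.unique q1
  exact p3.unique q3

/-- The functions `g ∈ H²(Ω)` with `g' = 0` on `∂Ω` for which moreover `v g ∈ L²(Ω)`, so that
`-ν g'' + i k v g` lies in `L²(Ω)`. The last requirement is automatic for bounded `v`. -/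
def neumannDomain (Ω : Opens ℝ) (v : ℝ → ℝ) : Submodule ℂ (X Ω) where
  carrier := {g | (∃ g₂ : X Ω, IsNeumannSecondDeriv Ω g g₂) ∧
    MemLp (fun y => (v y : ℂ) * g y) 2 (volume.restrict (Ω : Set ℝ))}
  add_mem' := by
    rintro g h ⟨⟨a, ha⟩, hg⟩ ⟨⟨b, hb⟩, hh⟩
    refine ⟨⟨a + b, ha.add hb⟩, (memLp_congr_ae ?_).2 (hg.add hh)⟩
    filter_upwards [Lp.coeFn_add g h] with y hy
    exact (congrArg (fun t => (v y : ℂ) * t) hy).trans (mul_add _ _ _)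
  zero_mem' := by
    refine ⟨⟨0, 0, isWeakDeriv_zero Ω, hasZeroTrace_zero Ω, isWeakDeriv_zero Ω⟩,
      (memLp_congr_ae ?_).2 (MemLp.zero (ε := ℂ))⟩
    filter_upwards [Lp.coeFn_zero ℂ 2 (volume.restrict (Ω : Set ℝ))] with y hy
    exact (congrArg (fun t => (v y : ℂ) * t) hy).trans (mul_zero _)
  smul_mem' := by
    rintro c g ⟨⟨a, ha⟩, hg⟩
    refine ⟨⟨c • a, ha.smul c⟩, (memLp_congr_ae ?_).2 (hg.const_smul c)⟩
    filter_upwards [Lp.coeFn_smul c g] with y hy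
    exact (congrArg (fun t => (v y : ℂ) * t) hy).trans (mul_left_comm _ _ _)

/-- The second weak derivative `g''` of an element of `neumannDomain`. -/
def secondDeriv {Ω : Opens ℝ} {v : ℝ → ℝ} (g : neumannDomain Ω v) : X Ω := g.2.1.choose

lemma secondDeriv_spec {Ω : Opens ℝ} {v : ℝ → ℝ} (g : neumannDomain Ω v) :
    IsNeumannSecondDeriv Ω g (secondDeriv g) := g.2.1.choose_spec

/-- The product `v g`, as an element of `L²(Ω)`. -/
def mulV {Ω : Opens ℝ} {v : ℝ → ℝ} (g : neumannDomain Ω v) : X Ω := g.2.2.toLp _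

lemma mulV_spec {Ω : Opens ℝ} {v : ℝ → ℝ} (g : neumannDomain Ω v) :
    ∀ᵐ y ∂(volume.restrict (Ω : Set ℝ)), mulV g y = (v y : ℂ) * (g : X Ω) y :=
  g.2.2.coeFn_toLp

/-- The differential operator `-ν ∂_y² + i k v(y)` with Neumann conditions, on `neumannDomain`. -/
def operatorCore (Ω : Opens ℝ) (v : ℝ → ℝ) (ν k : ℝ) : X Ω →ₗ.[ℂ] X Ω where
  domain := neumannDomain Ω v
  toFun :=
    { toFun := fun g => -((ν : ℂ) • secondDeriv g) + (Complex.I * (k : ℂ)) • mulV g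
      map_add' := by
        intro g h
        have h1 : secondDeriv (g + h) = secondDeriv g + secondDeriv h :=
          (secondDeriv_spec (g + h)).unique ((secondDeriv_spec g).add (secondDeriv_spec h))
        have h2 : mulV (g + h) = mulV g + mulV h := by
          refine Lp.ext ?_
          filter_upwards [mulV_spec (g + h), mulV_spec g, mulV_spec h,
            Lp.coeFn_add (mulV g) (mulV h), Lp.coeFn_add (g : X Ω) (h : X Ω)] with y a b c d e
          rw [a, d, Pi.add_apply, b, c, Submodule.coe_add, e, Pi.add_apply, mul_add]
        rw [h1, h2, smul_add, smul_add]
        abel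
      map_smul' := by
        intro c g
        have h1 : secondDeriv (c • g) = c • secondDeriv g :=
          (secondDeriv_spec (c • g)).unique ((secondDeriv_spec g).smul c)
        have h2 : mulV (c • g) = c • mulV g := by
          refine Lp.ext ?_
          filter_upwards [mulV_spec (c • g), mulV_spec g,
            Lp.coeFn_smul c (mulV g), Lp.coeFn_smul c (g : X Ω)] with y a b d e
          rw [a, d, Pi.smul_apply, b, Submodule.coe_smul, e, Pi.smul_apply, smul_eq_mul,
            smul_eq_mul, mul_left_comm]
        rw [h1, h2, smul_comm, smul_comm _ c, RingHom.id_apply, smul_add, smul_neg] }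

/-- The operator `H_{ν,k} = -ν ∂_y² + i k v(y)` on `L²(Ω)`: the closure of the differential
operator on `neumannDomain`. (A closed operator is its own closure; for `v` growing very
irregularly, the operator on `neumannDomain` is only closable.) -/
def H (Ω : Opens ℝ) (v : ℝ → ℝ) (ν k : ℝ) : X Ω →ₗ.[ℂ] X Ω :=
  (operatorCore Ω v ν k).closure

section Resolvent

variable {E : Type*} [NormedAddCommGroup E] [NormedSpace ℂ E]

/-- The bounded operator `R` is the inverse `(A - z)⁻¹` of `A - z : D(A) → E`. -/
def IsResolvent (A : E →ₗ.[ℂ] E) (z : ℂ) (R : E →L[ℂ] E) : Prop :=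
  (∀ f : E, ∃ h : R f ∈ A.domain, A ⟨R f, h⟩ - z • R f = f) ∧
    ∀ g : A.domain, R (A g - z • (g : E)) = g

/-- `‖(A - z)⁻¹‖ ∈ [0, ∞]`, equal to `∞` when `A - z` has no bounded everywhere defined inverse,
that is, when `z` is in the spectrum of `A`. (The resolvent is unique if it exists.) -/
def resolventNorm (A : E →ₗ.[ℂ] E) (z : ℂ) : ℝ≥0∞ :=
  ⨅ (R : E →L[ℂ] E) (_ : IsResolvent A z R), ‖R‖ₑ

/-- The pseudospectral abscissa `Ψ(A) = (sup_{z ∈ iℝ} ‖(A - z)⁻¹‖)⁻¹`. -/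
def pseudospectralAbscissa (A : E →ₗ.[ℂ] E) : ℝ≥0∞ :=
  (⨆ s : ℝ, resolventNorm A ((s : ℂ) * Complex.I))⁻¹

end Resolvent

/-- The decay rate `λ_{ν,k}`. -/
def rate (m : ℕ) (ν k : ℝ) : ℝ :=
  if ν ≤ |k| then ν ^ ((m : ℝ) / (m + 2)) * |k| ^ ((2 : ℝ) / (m + 2)) else k ^ 2 / ν

end ShearFlow

end

/-! Everything reduces to one estimate, uniform in real `s`: writing `W = k v - s` and `F = -ν g'' +
i W g`, one needs `λ ‖g‖ ≤ M ‖F‖`, with `M` depending only on the geometry of `v`, together with the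
existence of the resolvent on the imaginary axis.

Estimate. The real part of `⟨F, g⟩` gives `ν ‖g'‖² ≤ ‖F‖ ‖g‖`. The imaginary part sees `∫ W |g|²`,
which is useful only where `W` keeps its sign. Nondegeneracy supplies such places
(`exists_proportional_subinterval`): every interval of length `δ ≤ 1` contains a subinterval of
length `l δ` on which `v - σ` has one sign and size at least `c δ ^ m`, with `l`, `c` independent of
the interval and of the level `σ`. A bump multiplier there controls the minimum of `|g|²` on the
subinterval, and `g'` carries this control to the whole interval. Summing over a tiling gives, up to
constants, `‖g‖² ≲ (‖F‖ ‖g‖ + (ν / δ) ‖g'‖ ‖g‖) / (|k| δ ^ m) + δ² ‖g'‖²`. Inserting the energy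
bound, the terms balance when `δ ^ (m + 2) = ν / |k|`; if `ν > |k|` the scale is capped at `δ = 1`,
and the middle term yields the rate `k² / ν`. This is `interval_estimate` combined with
`exists_scale`.

Existence. The estimate is proved for smooth compactly supported Neumann functions only, so the
range of the operator on them must be dense and the closure must have no imaginary eigenvalue. Both
follow from `eq_zero_of_weak_neumann_solution`: an `L²` weak Neumann solution of `f'' = i Q f` with
`Q` real, reflected evenly to the line, is classical with `(|f|²)'' = 2 |f'|² ≥ 0`, and a
nonnegative integrable convex function on the line is zero. `exists_isResolvent_closure` assembles
these facts. -/

noncomputable section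

namespace ShearFlow

/-! ### Sublevel geometry of `v`: signed subintervals at every scale. -/

section Geometry

/-- A function whose derivative is at least `h` on an interval is at least `h L / 4` in absolute
value, with a constant sign, on a quarter of the interval. -/
lemma exists_quarter_of_le_deriv {u u' : ℝ → ℝ} {p L h : ℝ} (hL : 0 < L) (hh : 0 < h)
    (hc : ContinuousOn u (Icc p (p + L))) (hd : ∀ x ∈ Ioo p (p + L), HasDerivAt u (u' x) x)
    (hb : ∀ x ∈ Icc p (p + L), h ≤ u' x) :
    ∃ r, p ≤ r ∧ r + L / 4 ≤ p + L ∧ ((∀ x ∈ Icc r (r + L / 4), h * (L / 4) ≤ u x) ∨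
      ∀ x ∈ Icc r (r + L / 4), h * (L / 4) ≤ - u x) := by
  have key : ∀ x ∈ Icc p (p + L), ∀ y ∈ Icc p (p + L), x ≤ y → h * (y - x) ≤ u y - u x := by
    refine (convex_Icc p (p + L)).mul_sub_le_image_sub_of_le_deriv hc ?_ ?_
    · rw [interior_Icc]
      exact fun x hx => (hd x hx).differentiableAt.differentiableWithinAt
    · rw [interior_Icc]
      intro x hx
      rw [(hd x hx).deriv]
      exact hb x ⟨hx.1.le, hx.2.le⟩
  have hm : p + L / 2 ∈ Icc p (p + L) := ⟨by linarith, by linarith⟩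
  -- The sign at the midpoint selects the outer quarter: moving at least `L / 4` from the midpoint
  -- in the favourable direction gains `h * (L / 4)`.
  rcases le_total 0 (u (p + L / 2)) with h0 | h0
  · refine ⟨p + 3 * L / 4, by linarith, by linarith, Or.inl fun x hx => ?_⟩
    have := key _ hm x ⟨by linarith [hx.1], by linarith [hx.2]⟩ (by linarith [hx.1])
    have h2 : h * (L / 4) ≤ h * (x - (p + L / 2)) :=
      mul_le_mul_of_nonneg_left (by linarith [hx.1]) hh.le
    linarith
  · refine ⟨p, le_rfl, by linarith, Or.inr fun x hx => ?_⟩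
    have := key x ⟨by linarith [hx.1], by linarith [hx.2]⟩ _ hm (by linarith [hx.2])
    have h2 : h * (L / 4) ≤ h * ((p + L / 2) - x) :=
      mul_le_mul_of_nonneg_left (by linarith [hx.2]) hh.le
    linarith

/-- Descend one order at a time with the quarter lemma. Each step divides the length by 4 and
multiplies the lower bound by the new length; all these lengths are at least `L / 4 ^ j`, whence the
factor `(L / 4 ^ j) ^ j`. -/
lemma exists_subinterval_of_le_iterated_deriv {U : ℕ → ℝ → ℝ} (j : ℕ) :
    ∀ {p L h : ℝ}, 0 < L → 0 < h → (∀ i < j, ContinuousOn (U i) (Icc p (p + L))) →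
    (∀ i < j, ∀ x ∈ Ioo p (p + L), HasDerivAt (U i) (U (i + 1) x) x) →
    ((∀ x ∈ Icc p (p + L), h ≤ U j x) ∨ ∀ x ∈ Icc p (p + L), h ≤ - U j x) →
    ∃ r, p ≤ r ∧ r + L / 4 ^ j ≤ p + L ∧
      ((∀ x ∈ Icc r (r + L / 4 ^ j), h * (L / 4 ^ j) ^ j ≤ U 0 x) ∨
      ∀ x ∈ Icc r (r + L / 4 ^ j), h * (L / 4 ^ j) ^ j ≤ - U 0 x) := by
  induction j with
  | zero =>
    intro p L h hL hh _ _ hb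
    exact ⟨p, le_rfl, by simp, by simpa using hb⟩
  | succ j ih =>
    intro p L h hL hh hc hd hb
    have step : ∃ r, p ≤ r ∧ r + L / 4 ≤ p + L ∧
        ((∀ x ∈ Icc r (r + L / 4), h * (L / 4) ≤ U j x) ∨
        ∀ x ∈ Icc r (r + L / 4), h * (L / 4) ≤ - U j x) := by
      rcases hb with hb | hb
      · exact exists_quarter_of_le_deriv hL hh (hc j (by omega)) (hd j (by omega)) hb
      · obtain ⟨r, h1, h2, h3⟩ := exists_quarter_of_le_deriv (u := fun x => - U j x)
          (u' := fun x => - U (j + 1) x) hL hh (hc j (by omega)).neg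
          (fun x hx => (hd j (by omega) x hx).neg) hb
        refine ⟨r, h1, h2, ?_⟩
        simp only [neg_neg] at h3
        exact h3.symm
    obtain ⟨r, h1, h2, h3⟩ := step
    have hsub : Icc r (r + L / 4) ⊆ Icc p (p + L) := Icc_subset_Icc h1 h2
    have hsub' : Ioo r (r + L / 4) ⊆ Ioo p (p + L) := Ioo_subset_Ioo h1 h2
    obtain ⟨t, t1, t2, t3⟩ := ih (p := r) (L := L / 4) (h := h * (L / 4)) (by positivity)
      (by positivity) (fun i hi => (hc i (by omega)).mono hsub)
      (fun i hi x hx => hd i (by omega) x (hsub' hx)) h3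
    have e : L / 4 / 4 ^ j = L / 4 ^ (j + 1) := by rw [pow_succ]; field_simp
    rw [e] at t2 t3
    have hle : h * (L / 4 ^ (j + 1)) ^ (j + 1) ≤ h * (L / 4) * (L / 4 ^ (j + 1)) ^ j := by
      rw [pow_succ (L / 4 ^ (j + 1)) j, mul_comm (_ ^ j), mul_assoc]
      have : L / 4 ^ (j + 1) ≤ L / 4 := by
        apply div_le_div_of_nonneg_left hL.le (by norm_num)
        exact le_self_pow₀ (by norm_num) (by omega)
      gcongr
    refine ⟨t, h1.trans t1, t2.trans h2, ?_⟩
    rcases t3 with t3 | t3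
    · exact Or.inl fun x hx => hle.trans (t3 x hx)
    · exact Or.inr fun x hx => hle.trans (t3 x hx)

/-- Uniform nondegeneracy: on short intervals, one derivative of order between `1` and `m` stays
away from zero. -/
lemma exists_uniform_nondegeneracy {m : ℕ} (hm : 1 ≤ m) {S : Set ℝ} (hS : UniqueDiffOn ℝ S)
    (hcl : IsClosed S) {v : ℝ → ℝ} (hv : ContDiffOn ℝ m v S)
    (hnondeg : ∀ y ∈ S, 0 < ∑ j ∈ Finset.Icc 1 m, |iteratedDerivWithin j v S y|)
    {c₀ : ℝ} (hc₀ : 0 < c₀) (hinfty : ENNReal.ofReal c₀ ≤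
      liminf (fun y => ENNReal.ofReal |derivWithin v S y|) (cocompact ℝ ⊓ 𝓟 S)) :
    ∃ r c : ℝ, 0 < r ∧ r ≤ 1 ∧ 0 < c ∧ ∀ a δ : ℝ, 0 < δ → δ ≤ r → Icc a (a + δ) ⊆ S →
      ∃ j, 1 ≤ j ∧ j ≤ m ∧ ∀ x ∈ Icc a (a + δ), c ≤ |iteratedDerivWithin j v S x| := by
  have hev : ∀ᶠ y in cocompact ℝ ⊓ 𝓟 S, ENNReal.ofReal (c₀ / 2) <
      ENNReal.ofReal |derivWithin v S y| := by
    refine eventually_lt_of_lt_liminf (lt_of_lt_of_le ?_ hinfty)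
    exact (ENNReal.ofReal_lt_ofReal_iff hc₀).2 (by linarith)
  rw [eventually_inf_principal, ← Metric.cobounded_eq_cocompact,
    (Metric.hasBasis_cobounded_compl_closedBall (0 : ℝ)).eventually_iff] at hev
  obtain ⟨R, -, hR⟩ := hev
  -- The margin 2 separates two cases for intervals of length at most 1: those starting within `|R|
  -- + 1` of the origin stay in `K`, the others avoid the ball of radius `R`.
  set K : Set ℝ := S ∩ Icc (-(|R| + 2)) (|R| + 2) with hK
  have hKc : IsCompact K := isCompact_Icc.inter_left hcl
  have hcont : ∀ j ≤ m, ContinuousOn (iteratedDerivWithin j v S) S := fun j hj =>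
    hv.continuousOn_iteratedDerivWithin (by exact_mod_cast hj) hS
  have hsum : ContinuousOn (fun y => ∑ j ∈ Finset.Icc 1 m, |iteratedDerivWithin j v S y|) K := by
    refine continuousOn_finsetSum _ fun j hj => ?_
    exact ((hcont j (Finset.mem_Icc.1 hj).2).mono inter_subset_left).abs
  obtain ⟨s, hs, hsK⟩ : ∃ s, 0 < s ∧ ∀ y ∈ K,
      s ≤ ∑ j ∈ Finset.Icc 1 m, |iteratedDerivWithin j v S y| := by
    rcases K.eq_empty_or_nonempty with h | h
    · exact ⟨1, one_pos, by simp [h]⟩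
    · obtain ⟨y, hy, hmin⟩ := hKc.exists_isMinOn h hsum
      exact ⟨_, hnondeg y hy.1, fun x hx => hmin hx⟩
  have hm0 : (0 : ℝ) < m := by exact_mod_cast hm
  -- Bundling all derivatives into one vector gives a single modulus of continuity for every order.
  have hvec : UniformContinuousOn
      (fun y => fun j : Fin (m + 1) => iteratedDerivWithin j v S y) K := by
    refine hKc.uniformContinuousOn_of_continuous (continuousOn_pi.2 fun j => ?_)
    exact (hcont j (Nat.lt_succ_iff.1 j.2)).mono inter_subset_left
  rw [Metric.uniformContinuousOn_iff] at hvec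
  obtain ⟨d, hd, hdist⟩ := hvec (s / (2 * m)) (by positivity)
  refine ⟨min (d / 2) 1, min (s / (2 * m)) (c₀ / 2), by positivity, min_le_right _ _,
    by positivity, fun a δ hδ hδr hsub => ?_⟩
  have hδ1 : δ ≤ 1 := hδr.trans (min_le_right _ _)
  have hδd : δ ≤ d / 2 := hδr.trans (min_le_left _ _)
  have haS : a ∈ Icc a (a + δ) := ⟨le_rfl, by linarith⟩
  by_cases ha : |a| ≤ |R| + 1
  · have hIK : ∀ x ∈ Icc a (a + δ), x ∈ K := fun x hx =>
      ⟨hsub hx, by linarith [hx.1, (abs_le.1 ha).1], by linarith [hx.2, (abs_le.1 ha).2]⟩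
    -- By pigeonhole some order carries at least `s / m` at the left endpoint; uniform continuity
    -- loses at most half of it along the interval.
    obtain ⟨j, hj, hjs⟩ : ∃ j ∈ Finset.Icc 1 m, s / m ≤ |iteratedDerivWithin j v S a| := by
      by_contra! hcon
      have hlt := Finset.sum_lt_sum_of_nonempty ⟨1, Finset.mem_Icc.2 ⟨le_rfl, hm⟩⟩ hcon
      rw [Finset.sum_const, Nat.card_Icc, nsmul_eq_mul, Nat.add_sub_cancel,
        mul_div_cancel₀ _ hm0.ne'] at hlt
      exact absurd (hsK a (hIK a haS)) (not_le.2 hlt)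
    obtain ⟨hj1, hjm⟩ := Finset.mem_Icc.1 hj
    refine ⟨j, hj1, hjm, fun x hx => (min_le_left _ _).trans ?_⟩
    have h1 := hdist x (hIK x hx) a (hIK a haS) (by
      rw [Real.dist_eq, abs_of_nonneg (by linarith [hx.1])]; linarith [hx.2])
    have h2 := (dist_le_pi_dist _ _ (⟨j, by omega⟩ : Fin (m + 1))).trans_lt h1
    simp only [Real.dist_eq] at h2
    have h3 := abs_sub_abs_le_abs_sub (iteratedDerivWithin j v S a) (iteratedDerivWithin j v S x)
    rw [abs_sub_comm] at h3
    have h4 : s / m = 2 * (s / (2 * m)) := by field_simp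
    linarith
  · refine ⟨1, le_rfl, hm, fun x hx => (min_le_right _ _).trans ?_⟩
    have hx' : x ∈ (Metric.closedBall (0 : ℝ) R)ᶜ := by
      rw [mem_compl_iff, Metric.mem_closedBall, Real.dist_eq, sub_zero, not_le]
      have h3 := abs_sub_abs_le_abs_sub a x
      have h4 : |a - x| ≤ 1 := abs_le.2 ⟨by linarith [hx.2], by linarith [hx.1]⟩
      linarith [le_abs_self R]
    have := hR hx' (hsub hx)
    rw [iteratedDerivWithin_one]
    exact ((ENNReal.ofReal_lt_ofReal_iff_of_nonneg (by positivity)).1 this).le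

/-- `v - σ` keeps a constant sign and is of size at least `c δ ^ m` on a fixed proportion of every
interval of length `δ ≤ 1`. -/
lemma exists_proportional_subinterval {m : ℕ} (hm : 1 ≤ m) {S : Set ℝ} (hS : UniqueDiffOn ℝ S)
    (hcl : IsClosed S) {v : ℝ → ℝ} (hv : ContDiffOn ℝ m v S)
    (hnondeg : ∀ y ∈ S, 0 < ∑ j ∈ Finset.Icc 1 m, |iteratedDerivWithin j v S y|)
    {c₀ : ℝ} (hc₀ : 0 < c₀) (hinfty : ENNReal.ofReal c₀ ≤
      liminf (fun y => ENNReal.ofReal |derivWithin v S y|) (cocompact ℝ ⊓ 𝓟 S)) :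
    ∃ l c : ℝ, 0 < l ∧ 0 < c ∧ ∀ a δ σ : ℝ, 0 < δ → δ ≤ 1 → Icc a (a + δ) ⊆ S →
      ∃ p, a ≤ p ∧ p + l * δ ≤ a + δ ∧ ((∀ x ∈ Icc p (p + l * δ), c * δ ^ m ≤ v x - σ) ∨
        ∀ x ∈ Icc p (p + l * δ), c * δ ^ m ≤ -(v x - σ)) := by
  obtain ⟨r, c, hr, hr1, hc, H⟩ := exists_uniform_nondegeneracy hm hS hcl hv hnondeg hc₀ hinfty
  refine ⟨r / 4 ^ m, c * (r / 4 ^ m) ^ m, by positivity, by positivity,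
    fun a δ σ hδ hδ1 hsub => ?_⟩
  -- Nondegeneracy is available up to scale `r`, so only the initial part of length `r * δ` is used.
  have hrδ : r * δ ≤ δ := by nlinarith
  have hsub' : Icc a (a + r * δ) ⊆ S := (Icc_subset_Icc_right (by linarith)).trans hsub
  obtain ⟨j, hj1, hjm, hj⟩ := H a (r * δ) (by positivity) (by nlinarith) hsub'
  -- The level enters at order zero only; the derivatives of positive order, hence all constants, do
  -- not see `σ`.
  set U : ℕ → ℝ → ℝ := fun i x => iteratedDerivWithin i v S x - if i = 0 then σ else 0 with hU
  have hcont : ∀ i ≤ m, ContinuousOn (U i) (Icc a (a + r * δ)) := fun i hi =>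
    ((hv.continuousOn_iteratedDerivWithin (by exact_mod_cast hi) hS).mono hsub').sub
      continuousOn_const
  have hder : ∀ i < j, ∀ x ∈ Ioo a (a + r * δ), HasDerivAt (U i) (U (i + 1) x) x := by
    intro i hi x hx
    have hxS : S ∈ 𝓝 x := mem_of_superset (Icc_mem_nhds hx.1 hx.2) hsub'
    have h1 : DifferentiableWithinAt ℝ (iteratedDerivWithin i v S) S x :=
      hv.differentiableOn_iteratedDerivWithin (by exact_mod_cast lt_of_lt_of_le hi hjm) hS x
        (hsub' ⟨hx.1.le, hx.2.le⟩)
    have h2 := (h1.hasDerivWithinAt.hasDerivAt hxS).sub_const (if i = 0 then σ else 0)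
    rw [← iteratedDerivWithin_succ] at h2
    simpa [hU] using h2
  have hUj : ∀ x, U j x = iteratedDerivWithin j v S x := fun x => by
    simp [hU, show j ≠ 0 by omega]
  have hne : ∀ x ∈ Icc a (a + r * δ), U j x ≠ 0 := fun x hx h0 => by
    have := hj x hx
    rw [← hUj, h0, abs_zero] at this
    linarith
  have hsign : (∀ x ∈ Icc a (a + r * δ), c ≤ U j x) ∨ ∀ x ∈ Icc a (a + r * δ), c ≤ - U j x := by
    have hpre : IsPreconnected (U j '' Icc a (a + r * δ)) :=
      isPreconnected_Icc.image _ (hcont j hjm)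
    by_cases hpos : ∀ x ∈ Icc a (a + r * δ), 0 < U j x
    · left
      intro x hx
      have := hj x hx
      rwa [← hUj, abs_of_pos (hpos x hx)] at this
    · right
      push Not at hpos
      obtain ⟨y, hy, hy0⟩ := hpos
      intro x hx
      have := hj x hx
      rw [← hUj] at this
      rcases le_or_gt (U j x) 0 with h | h
      · rwa [abs_of_nonpos h] at this
      · exfalso
        obtain ⟨z, hz, hz0⟩ := hpre.ordConnected.out (mem_image_of_mem _ hy)
          (mem_image_of_mem _ hx) ⟨hy0, h.le⟩
        exact hne z hz hz0
  obtain ⟨p, h1, h2, h3⟩ := exists_subinterval_of_le_iterated_deriv (U := U) j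
    (p := a) (L := r * δ) (h := c) (by positivity) hc (fun i hi => hcont i (by omega)) hder hsign
  have hlen : r / 4 ^ m * δ ≤ r * δ / 4 ^ j := by
    rw [div_mul_eq_mul_div]
    exact div_le_div_of_nonneg_left (by positivity) (by positivity)
      (pow_le_pow_right₀ (by norm_num) hjm)
  -- The order `j` varies with the interval. As the base is at most 1 and `j ≤ m`, the power `m` is
  -- the worst case and gives a bound free of `j`.
  have hheight : c * (r / 4 ^ m) ^ m * δ ^ m ≤ c * (r * δ / 4 ^ j) ^ j := by
    have hb : r / 4 ^ m * δ ≤ 1 := by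
      have : r / 4 ^ m ≤ 1 := (div_le_self hr.le (one_le_pow₀ (by norm_num))).trans hr1
      nlinarith [show 0 < r / 4 ^ m by positivity]
    rw [mul_assoc, ← mul_pow]
    refine mul_le_mul_of_nonneg_left ?_ hc.le
    exact (pow_le_pow_of_le_one (by positivity) hb hjm).trans
      (pow_le_pow_left₀ (by positivity) hlen _)
  have hUz : ∀ x, U 0 x = v x - σ := fun x => by simp [hU]
  refine ⟨p, h1, by linarith, ?_⟩
  rcases h3 with h3 | h3
  · exact Or.inl fun x hx => by
      rw [← hUz]; exact hheight.trans (h3 x ⟨hx.1, by linarith [hx.2]⟩)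
  · exact Or.inr fun x hx => by
      rw [← hUz]; exact hheight.trans (h3 x ⟨hx.1, by linarith [hx.2]⟩)

end Geometry

/-! ### Multiplier and energy estimates on bounded intervals. -/

section LocalEstimate

open ComplexConjugate intervalIntegral

lemma sq_intervalIntegral_mul_le {f g : ℝ → ℝ} {a b : ℝ} (hab : a ≤ b)
    (hf : ContinuousOn f (Icc a b)) (hg : ContinuousOn g (Icc a b)) :
    (∫ x in a..b, f x * g x) ^ 2 ≤ (∫ x in a..b, f x ^ 2) * ∫ x in a..b, g x ^ 2 := by
  rw [← uIcc_of_le hab] at hf hg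
  have hff : IntervalIntegrable (fun x => f x ^ 2) volume a b := (hf.pow 2).intervalIntegrable
  have hgg : IntervalIntegrable (fun x => g x ^ 2) volume a b := (hg.pow 2).intervalIntegrable
  have hfg : IntervalIntegrable (fun x => f x * g x) volume a b := (hf.mul hg).intervalIntegrable
  have h : ∀ t : ℝ, 0 ≤ (∫ x in a..b, g x ^ 2) * (t * t) + (-2 * ∫ x in a..b, f x * g x) * t
      + ∫ x in a..b, f x ^ 2 := by
    intro t
    have h0 : 0 ≤ ∫ x in a..b, (f x - t * g x) ^ 2 :=
      integral_nonneg hab fun x _ => sq_nonneg _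
    have e : ∀ x, (f x - t * g x) ^ 2 = f x ^ 2 - (2 * t) * (f x * g x) + (t * t) * g x ^ 2 :=
      fun x => by ring
    simp_rw [e] at h0
    rw [integral_add (hff.sub (hfg.const_mul _)) (hgg.const_mul _),
      integral_sub hff (hfg.const_mul _), intervalIntegral.integral_const_mul, intervalIntegral.integral_const_mul] at h0
    linarith
  have := discrim_le_zero h
  rw [discrim] at this
  nlinarith

variable {G G₁ G₂ : ℝ → ℂ}

lemma hasDerivAt_mul_conj (hG : ∀ x, HasDerivAt G (G₁ x) x) (hG₁ : ∀ x, HasDerivAt G₁ (G₂ x) x)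
    (x : ℝ) : HasDerivAt (fun x => G₁ x * conj (G x)) (G₂ x * conj (G x) + G₁ x * conj (G₁ x)) x :=
  (hG₁ x).mul ((hG x).star)

/-- Testing `-ν G'' + i W G` against a multiple of `G` supported where `W` has a constant sign. -/
lemma multiplier_estimate (hG : ∀ x, HasDerivAt G (G₁ x) x) (hG₁ : ∀ x, HasDerivAt G₁ (G₂ x) x)
    (hG₂ : Continuous G₂) {W : ℝ → ℝ} {p q ν η M : ℝ} (hpq : p < q) (hν : 0 < ν)
    (hη : 0 ≤ η) (hW : ContinuousOn W (Icc p q))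
    (hs : (∀ x ∈ Icc p q, η ≤ W x) ∨ ∀ x ∈ Icc p q, η ≤ - W x)
    (hM : ∀ x ∈ Icc p q, M ≤ ‖G x‖ ^ 2) :
    η * M * (2 * (q - p) / 3) ≤
      (∫ x in p..q, ‖-(ν : ℂ) * G₂ x + Complex.I * W x * G x‖ * ‖G x‖) +
        ν * (4 / (q - p)) * ∫ x in p..q, ‖G₁ x‖ * ‖G x‖ := by
  have hd : 0 < q - p := by linarith
  have cG : Continuous G := continuous_iff_continuousAt.2 fun x => (hG x).continuousAt
  have cG₁ : Continuous G₁ := continuous_iff_continuousAt.2 fun x => (hG₁ x).continuousAt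
  obtain ⟨ε, hε, hεW⟩ : ∃ ε : ℝ, |ε| = 1 ∧ ∀ x ∈ Icc p q, η ≤ ε * W x := by
    rcases hs with h | h
    · exact ⟨1, by simp, by simpa using h⟩
    · exact ⟨-1, by simp, by simpa using h⟩
  -- A parabola vanishing at both ends with maximum 1: no boundary condition on `G` is needed at
  -- `p`, `q`, its mean is `2 / 3`, and its slope is at most `4 / (q - p)`.
  set φ : ℝ → ℝ := fun x => 4 * (x - p) * (q - x) / (q - p) ^ 2 with hφ
  set φ' : ℝ → ℝ := fun x => 4 * (p + q - 2 * x) / (q - p) ^ 2 with hφ'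
  have hφd : ∀ x, HasDerivAt φ (φ' x) x := fun x => by
    have := ((((hasDerivAt_id x).sub_const p).const_mul 4).mul
      ((hasDerivAt_id x).const_sub q)).div_const ((q - p) ^ 2)
    refine this.congr_deriv ?_
    simp only [hφ', id]
    ring
  set S : ℝ → ℝ := fun x => (G₁ x * conj (G x)).im with hS
  set S' : ℝ → ℝ := fun x => (G₂ x * conj (G x)).im with hS'
  have hSd : ∀ x, HasDerivAt S (S' x) x := fun x => by
    have h := Complex.imCLM.hasFDerivAt.comp_hasDerivAt x (hasDerivAt_mul_conj hG hG₁ x)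
    refine h.congr_deriv ?_
    simp [hS', Complex.mul_conj]
  have cφ' : Continuous φ' := by fun_prop
  have cφ : Continuous φ := by fun_prop
  have cconj : Continuous fun x => conj (G x) := Complex.continuous_conj.comp cG
  have cS : Continuous S := Complex.continuous_im.comp (cG₁.mul cconj)
  have cS' : Continuous S' := Complex.continuous_im.comp (hG₂.mul cconj)
  have hibp : ∫ x in p..q, (φ' x * S x + φ x * S' x) = 0 := by
    rw [integral_deriv_mul_eq_sub (fun x _ => hφd x) (fun x _ => hSd x)
      (cφ'.intervalIntegrable _ _) (cS'.intervalIntegrable _ _)]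
    simp [hφ]
  have hφint : ∫ x in p..q, φ x = 2 * (q - p) / 3 := by
    have hP : ∀ x, HasDerivAt (fun x : ℝ => 4 / (q - p) ^ 2 *
        (-(x ^ 3) / 3 + (p + q) * x ^ 2 / 2 - p * q * x)) (φ x) x := fun x => by
      have := (((((hasDerivAt_id x).pow 3).neg.div_const 3).add
        ((((hasDerivAt_id x).pow 2).const_mul (p + q)).div_const 2)).sub
        ((hasDerivAt_id x).const_mul (p * q))).const_mul (4 / (q - p) ^ 2)
      refine this.congr_deriv ?_
      simp only [hφ, id]
      push_cast
      ring
    rw [integral_eq_sub_of_hasDerivAt (fun x _ => hP x) (cφ.intervalIntegrable _ _)]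
    field_simp
    ring
  set f : ℝ → ℂ := fun x => -(ν : ℂ) * G₂ x + Complex.I * W x * G x with hf
  have cf : ContinuousOn f (Icc p q) := by
    refine (continuous_const.mul hG₂).continuousOn.add ((continuousOn_const.mul ?_).mul
      cG.continuousOn)
    exact Complex.continuous_ofReal.comp_continuousOn hW
  have i1 : IntervalIntegrable (fun x => ‖f x‖ * ‖G x‖) volume p q := by
    rw [← uIcc_of_le hpq.le] at cf
    exact (cf.norm.mul cG.norm.continuousOn).intervalIntegrable
  have i2 : IntervalIntegrable (fun x => ‖G₁ x‖ * ‖G x‖) volume p q :=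
    (cG₁.norm.mul cG.norm).intervalIntegrable _ _
  have i3 : IntervalIntegrable (fun x => φ' x * S x + φ x * S' x) volume p q :=
    ((cφ'.mul cS).add (cφ.mul cS')).intervalIntegrable _ _
  -- Here `Im (f * conj G) = -ν S' + W ‖G‖²`. The term `φ S'` is completed to `(φ S)'`, which
  -- integrates to zero, leaving the error `φ' S`.
  have hpt : ∀ x ∈ Icc p q, η * M * φ x ≤ (‖f x‖ * ‖G x‖ +
      ν * (4 / (q - p)) * (‖G₁ x‖ * ‖G x‖)) + ε * ν * (φ' x * S x + φ x * S' x) := by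
    intro x hx
    have hφ0 : 0 ≤ φ x := by
      have h1 : 0 ≤ x - p := by linarith [hx.1]
      have h2 : 0 ≤ q - x := by linarith [hx.2]
      positivity
    have hφ1 : φ x ≤ 1 := by
      rw [hφ, div_le_one (by positivity)]
      nlinarith [sq_nonneg (2 * x - p - q)]
    have hφ'1 : |φ' x| ≤ 4 / (q - p) := by
      rw [hφ', abs_div, abs_of_pos (by positivity : (0 : ℝ) < (q - p) ^ 2),
        div_le_div_iff₀ (by positivity) hd, abs_mul, abs_of_pos (by norm_num : (0 : ℝ) < 4)]
      have : |p + q - 2 * x| ≤ q - p := abs_le.2 ⟨by linarith [hx.2], by linarith [hx.1]⟩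
      nlinarith
    have him : (f x * conj (G x)).im = -ν * S' x + W x * ‖G x‖ ^ 2 := by
      simp only [hf, hS', ← Complex.normSq_eq_norm_sq, Complex.normSq_apply]
      simp
      ring
    have hS1 : |S x| ≤ ‖G₁ x‖ * ‖G x‖ := by
      refine (Complex.abs_im_le_norm _).trans ?_
      rw [norm_mul, RCLike.norm_conj]
    have hf1 : |(f x * conj (G x)).im| ≤ ‖f x‖ * ‖G x‖ := by
      refine (Complex.abs_im_le_norm _).trans ?_
      rw [norm_mul, RCLike.norm_conj]
    have hA : η * M * φ x ≤ ε * W x * ‖G x‖ ^ 2 * φ x := by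
      refine mul_le_mul_of_nonneg_right ?_ hφ0
      exact (mul_le_mul_of_nonneg_left (hM x hx) hη).trans
        (mul_le_mul_of_nonneg_right (hεW x hx) (sq_nonneg _))
    have hB : ε * W x * ‖G x‖ ^ 2 * φ x = ε * φ x * (f x * conj (G x)).im
        - ε * ν * φ' x * S x + ε * ν * (φ' x * S x + φ x * S' x) := by
      rw [him]; ring
    have hC : ε * φ x * (f x * conj (G x)).im ≤ ‖f x‖ * ‖G x‖ := by
      refine (le_abs_self _).trans ?_
      rw [abs_mul, abs_mul, hε, one_mul, abs_of_nonneg hφ0]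
      exact (mul_le_of_le_one_left (abs_nonneg _) hφ1).trans hf1
    have hD : -(ε * ν * φ' x * S x) ≤ ν * (4 / (q - p)) * (‖G₁ x‖ * ‖G x‖) := by
      refine (neg_le_abs _).trans ?_
      rw [abs_mul, abs_mul, abs_mul, hε, one_mul, abs_of_pos hν]
      gcongr
    linarith
  have hmono := integral_mono_on hpq.le ((cφ.const_mul (η * M)).intervalIntegrable _ _)
    ((i1.add (i2.const_mul _)).add (i3.const_mul _)) hpt
  rw [intervalIntegral.integral_const_mul, hφint] at hmono
  rw [integral_add (i1.add (i2.const_mul _)) (i3.const_mul _),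
    integral_add i1 (i2.const_mul _), intervalIntegral.integral_const_mul, intervalIntegral.integral_const_mul, hibp,
    mul_zero, add_zero] at hmono
  exact hmono

/-- The multiplier estimate bounds the minimum of `‖G‖²` over the signed subinterval. Any other
value of `G` on the tile differs from the minimizing one by at most `∫ ‖G₁‖`, which Cauchy–Schwarz
turns into the last term. -/
lemma tile_estimate (hG : ∀ x, HasDerivAt G (G₁ x) x) (hG₁ : ∀ x, HasDerivAt G₁ (G₂ x) x)
    (hG₂ : Continuous G₂) {W : ℝ → ℝ} {a p l δ ν η : ℝ} (hl : 0 < l) (hδ : 0 < δ) (hν : 0 < ν)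
    (hη : 0 < η) (hW : ContinuousOn W (Icc a (a + δ))) (hap : a ≤ p) (hpa : p + l * δ ≤ a + δ)
    (hs : (∀ x ∈ Icc p (p + l * δ), η ≤ W x) ∨ ∀ x ∈ Icc p (p + l * δ), η ≤ - W x) :
    ∫ x in a..a + δ, ‖G x‖ ^ 2 ≤ 3 / (l * η) *
      ((∫ x in a..a + δ, ‖-(ν : ℂ) * G₂ x + Complex.I * W x * G x‖ * ‖G x‖) +
        4 * ν / (l * δ) * ∫ x in a..a + δ, ‖G₁ x‖ * ‖G x‖) +
      2 * δ ^ 2 * ∫ x in a..a + δ, ‖G₁ x‖ ^ 2 := by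
  have hlδ : 0 < l * δ := by positivity
  have cG : Continuous G := continuous_iff_continuousAt.2 fun x => (hG x).continuousAt
  have cG₁ : Continuous G₁ := continuous_iff_continuousAt.2 fun x => (hG₁ x).continuousAt
  set f : ℝ → ℂ := fun x => -(ν : ℂ) * G₂ x + Complex.I * W x * G x with hf
  have cf : ContinuousOn f (uIcc a (a + δ)) := by
    rw [uIcc_of_le (by linarith)]
    refine (continuous_const.mul hG₂).continuousOn.add ((continuousOn_const.mul ?_).mul
      cG.continuousOn)
    exact Complex.continuous_ofReal.comp_continuousOn hW
  have i1 : IntervalIntegrable (fun x => ‖f x‖ * ‖G x‖) volume a (a + δ) :=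
    (cf.norm.mul cG.norm.continuousOn).intervalIntegrable
  have i2 : IntervalIntegrable (fun x => ‖G₁ x‖ * ‖G x‖) volume a (a + δ) :=
    (cG₁.norm.mul cG.norm).intervalIntegrable _ _
  obtain ⟨y, hy, hmin⟩ := (isCompact_Icc (a := p) (b := p + l * δ)).exists_isMinOn
    ⟨p, le_rfl, by linarith⟩ (cG.norm.pow 2).continuousOn
  have hJ := multiplier_estimate hG hG₁ hG₂ (M := ‖G y‖ ^ 2) (by linarith : p < p + l * δ) hν
    hη.le (hW.mono (Icc_subset_Icc hap hpa)) hs (fun x hx => hmin hx)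
  have m1 : ∫ x in p..p + l * δ, ‖f x‖ * ‖G x‖ ≤ ∫ x in a..a + δ, ‖f x‖ * ‖G x‖ :=
    integral_mono_interval hap (by linarith) hpa (ae_of_all _ fun x => by positivity) i1
  have m2 : ∫ x in p..p + l * δ, ‖G₁ x‖ * ‖G x‖ ≤ ∫ x in a..a + δ, ‖G₁ x‖ * ‖G x‖ :=
    integral_mono_interval hap (by linarith) hpa (ae_of_all _ fun x => by positivity) i2
  have hya : y ∈ Icc a (a + δ) := ⟨hap.trans hy.1, hy.2.trans hpa⟩
  have hlen : p + l * δ - p = l * δ := by ring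
  rw [hlen] at hJ
  have hGy : δ * (2 * ‖G y‖ ^ 2) ≤ 3 / (l * η) * ((∫ x in a..a + δ, ‖f x‖ * ‖G x‖) +
        4 * ν / (l * δ) * ∫ x in a..a + δ, ‖G₁ x‖ * ‖G x‖) := by
    have h1 : η * ‖G y‖ ^ 2 * (2 * (l * δ) / 3) ≤ (∫ x in a..a + δ, ‖f x‖ * ‖G x‖) +
        4 * ν / (l * δ) * ∫ x in a..a + δ, ‖G₁ x‖ * ‖G x‖ := by
      refine hJ.trans (add_le_add m1 ?_)
      rw [show ν * (4 / (l * δ)) = 4 * ν / (l * δ) by ring]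
      exact mul_le_mul_of_nonneg_left m2 (by positivity)
    have h2 := mul_le_mul_of_nonneg_left h1 (by positivity : 0 ≤ 3 / (l * η))
    refine le_trans (le_of_eq ?_) h2
    field_simp
  set B := ∫ x in a..a + δ, ‖G₁ x‖ ^ 2 with hB
  have hdiff : ∀ x ∈ Icc a (a + δ), ‖G x‖ ^ 2 ≤ 2 * ‖G y‖ ^ 2 + 2 * δ * B := by
    intro x hx
    have h1 : ‖G x - G y‖ ≤ ∫ t in a..a + δ, ‖G₁ t‖ := by
      rw [← integral_eq_sub_of_hasDerivAt (fun t _ => hG t) (cG₁.intervalIntegrable _ _)]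
      refine (norm_integral_le_abs_integral_norm).trans ?_
      refine (abs_integral_mono_interval (a := y) (b := x) (c := a) (d := a + δ) ?_
        (ae_of_all _ fun t => norm_nonneg _) (cG₁.norm.intervalIntegrable _ _)).trans ?_
      · rw [uIoc_of_le (by linarith : a ≤ a + δ)]
        exact Ioc_subset_Ioc (le_min hya.1 hx.1) (max_le hya.2 hx.2)
      · rw [abs_of_nonneg (integral_nonneg (by linarith) fun t _ => norm_nonneg _)]
    have h2 : (∫ t in a..a + δ, ‖G₁ t‖) ^ 2 ≤ δ * B := by
      have := sq_intervalIntegral_mul_le (f := fun _ => (1 : ℝ)) (g := fun t => ‖G₁ t‖)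
        (by linarith : a ≤ a + δ) continuousOn_const cG₁.norm.continuousOn
      simpa using this
    have h3 : ‖G x‖ ≤ ‖G y‖ + ‖G x - G y‖ := by
      have := norm_add_le (G y) (G x - G y)
      rwa [add_sub_cancel] at this
    have h4 : ‖G x - G y‖ ^ 2 ≤ δ * B := (pow_le_pow_left₀ (norm_nonneg _) h1 2).trans h2
    have h5 := pow_le_pow_left₀ (norm_nonneg _) h3 2
    nlinarith [sq_nonneg (‖G y‖ - ‖G x - G y‖)]
  have hfin : ∫ x in a..a + δ, ‖G x‖ ^ 2 ≤ δ * (2 * ‖G y‖ ^ 2 + 2 * δ * B) := by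
    refine (integral_mono_on (by linarith) ((cG.norm.pow 2).intervalIntegrable _ _)
      (continuous_const.intervalIntegrable _ _) hdiff).trans (le_of_eq ?_)
    rw [intervalIntegral.integral_const, smul_eq_mul]
    ring
  nlinarith

/-- The energy identity for `-ν G'' + i W G` under Neumann conditions. -/
lemma energy_estimate (hG : ∀ x, HasDerivAt G (G₁ x) x) (hG₁ : ∀ x, HasDerivAt G₁ (G₂ x) x)
    (hG₂ : Continuous G₂) {W : ℝ → ℝ} {a b ν : ℝ} (hab : a ≤ b)
    (hW : ContinuousOn W (Icc a b)) (ha : G₁ a = 0) (hb : G₁ b = 0) :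
    ν * ∫ x in a..b, ‖G₁ x‖ ^ 2 ≤
      ∫ x in a..b, ‖-(ν : ℂ) * G₂ x + Complex.I * W x * G x‖ * ‖G x‖ := by
  have cG : Continuous G := continuous_iff_continuousAt.2 fun x => (hG x).continuousAt
  have cG₁ : Continuous G₁ := continuous_iff_continuousAt.2 fun x => (hG₁ x).continuousAt
  set f : ℝ → ℂ := fun x => -(ν : ℂ) * G₂ x + Complex.I * W x * G x with hf
  have cf : ContinuousOn f (uIcc a b) := by
    rw [uIcc_of_le hab]
    refine (continuous_const.mul hG₂).continuousOn.add ((continuousOn_const.mul ?_).mul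
      cG.continuousOn)
    exact Complex.continuous_ofReal.comp_continuousOn hW
  have i1 : IntervalIntegrable (fun x => ‖f x‖ * ‖G x‖) volume a b :=
    (cf.norm.mul cG.norm.continuousOn).intervalIntegrable
  have cconj : Continuous fun x => conj (G x) := Complex.continuous_conj.comp cG
  have cconj₁ : Continuous fun x => conj (G₁ x) := Complex.continuous_conj.comp cG₁
  set T' : ℝ → ℝ := fun x => (G₂ x * conj (G x) + G₁ x * conj (G₁ x)).re with hT'
  have hTd : ∀ x, HasDerivAt (fun x => (G₁ x * conj (G x)).re) (T' x) x := fun x =>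
    Complex.reCLM.hasFDerivAt.comp_hasDerivAt x (hasDerivAt_mul_conj hG hG₁ x)
  have cT' : Continuous T' := Complex.continuous_re.comp ((hG₂.mul cconj).add (cG₁.mul cconj₁))
  have hT : ∫ x in a..b, T' x = 0 := by
    rw [integral_eq_sub_of_hasDerivAt (fun x _ => hTd x) (cT'.intervalIntegrable _ _)]
    simp [ha, hb]
  have hpt : ∀ x ∈ Icc a b, ν * ‖G₁ x‖ ^ 2 ≤ ‖f x‖ * ‖G x‖ + ν * T' x := by
    intro x _
    -- The potential contributes `i W ‖G‖²`, which has no real part, so `W` disappears.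
    have hre : (f x * conj (G x)).re = ν * ‖G₁ x‖ ^ 2 - ν * T' x := by
      simp only [hf, hT', ← Complex.normSq_eq_norm_sq, Complex.normSq_apply]
      simp
      ring
    have h1 : (f x * conj (G x)).re ≤ ‖f x‖ * ‖G x‖ := by
      refine (Complex.re_le_norm _).trans ?_
      rw [norm_mul, RCLike.norm_conj]
    linarith
  have c1 : Continuous fun x => ν * ‖G₁ x‖ ^ 2 := by fun_prop
  have hmono := integral_mono_on hab (c1.intervalIntegrable _ _)
    (i1.add ((cT'.intervalIntegrable _ _).const_mul ν)) hpt
  rwa [intervalIntegral.integral_const_mul, integral_add i1 ((cT'.intervalIntegrable _ _).const_mul ν),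
    intervalIntegral.integral_const_mul, hT, mul_zero, add_zero] at hmono

/-- Summation of the local estimates over a tiling. -/
lemma tiling_estimate (hG : ∀ x, HasDerivAt G (G₁ x) x) (hG₁ : ∀ x, HasDerivAt G₁ (G₂ x) x)
    (hG₂ : Continuous G₂) {W : ℝ → ℝ} {a l δ ν η : ℝ} (N : ℕ) (hl : 0 < l) (hδ : 0 < δ)
    (hν : 0 < ν) (hη : 0 < η) (hW : ContinuousOn W (Icc a (a + N * δ)))
    (htile : ∀ t, a ≤ t → t + δ ≤ a + N * δ → ∃ p, t ≤ p ∧ p + l * δ ≤ t + δ ∧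
      ((∀ x ∈ Icc p (p + l * δ), η ≤ W x) ∨ ∀ x ∈ Icc p (p + l * δ), η ≤ - W x)) :
    ∫ x in a..a + N * δ, ‖G x‖ ^ 2 ≤ 3 / (l * η) *
      ((∫ x in a..a + N * δ, ‖-(ν : ℂ) * G₂ x + Complex.I * W x * G x‖ * ‖G x‖) +
        4 * ν / (l * δ) * ∫ x in a..a + N * δ, ‖G₁ x‖ * ‖G x‖) +
      2 * δ ^ 2 * ∫ x in a..a + N * δ, ‖G₁ x‖ ^ 2 := by
  induction N with
  | zero => simp
  | succ N ih =>
    have cG : Continuous G := continuous_iff_continuousAt.2 fun x => (hG x).continuousAt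
    have cG₁ : Continuous G₁ := continuous_iff_continuousAt.2 fun x => (hG₁ x).continuousAt
    have e : a + ((N + 1 : ℕ) : ℝ) * δ = a + N * δ + δ := by push_cast; ring
    rw [e] at hW htile ⊢
    have hN : 0 ≤ N * δ := by positivity
    have h1 := ih (hW.mono (Icc_subset_Icc_right (by linarith)))
      (fun t ht1 ht2 => htile t ht1 (by linarith))
    obtain ⟨p, p1, p2, p3⟩ := htile (a + N * δ) (by linarith) le_rfl
    have h2 := tile_estimate hG hG₁ hG₂ hl hδ hν hη
      (hW.mono (Icc_subset_Icc_left (by linarith))) p1 p2 p3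
    set f : ℝ → ℂ := fun x => -(ν : ℂ) * G₂ x + Complex.I * W x * G x with hf
    have cf : ContinuousOn f (Icc a (a + N * δ + δ)) := by
      refine (continuous_const.mul hG₂).continuousOn.add ((continuousOn_const.mul ?_).mul
        cG.continuousOn)
      exact Complex.continuous_ofReal.comp_continuousOn hW
    have cfG := cf.norm.mul cG.norm.continuousOn
    have j1 : IntervalIntegrable (fun x => ‖f x‖ * ‖G x‖) volume a (a + N * δ) := by
      refine (cfG.mono ?_).intervalIntegrable
      rw [uIcc_of_le (by linarith)]
      exact Icc_subset_Icc_right (by linarith)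
    have j2 : IntervalIntegrable (fun x => ‖f x‖ * ‖G x‖) volume (a + N * δ) (a + N * δ + δ) := by
      refine (cfG.mono ?_).intervalIntegrable
      rw [uIcc_of_le (by linarith)]
      exact Icc_subset_Icc_left (by linarith)
    have adj : ∀ {g : ℝ → ℝ}, Continuous g → ∫ x in a..a + N * δ + δ, g x =
        (∫ x in a..a + N * δ, g x) + ∫ x in a + N * δ..a + N * δ + δ, g x := fun hg =>
      (integral_add_adjacent_intervals (hg.intervalIntegrable _ _)
        (hg.intervalIntegrable _ _)).symm
    have c1 : Continuous fun x => ‖G x‖ ^ 2 := by fun_prop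
    have c2 : Continuous fun x => ‖G₁ x‖ * ‖G x‖ := by fun_prop
    have c3 : Continuous fun x => ‖G₁ x‖ ^ 2 := by fun_prop
    rw [← integral_add_adjacent_intervals j1 j2, adj c1, adj c2, adj c3]
    refine (add_le_add h1 h2).trans (le_of_eq ?_)
    ring

/-- Here `A`, `B`, `F` stand for the norms of `G`, `G'` and the right-hand side. After multiplying
`hmain` by `r`, the first and last terms are bounded by multiples of `F * A` and the mixed term is
split by Young's inequality. Half of `r * A ^ 2` is absorbed, which doubles `K + K ^ 2 / 2 + 2`. -/
lemma le_of_quadratic_bounds {A B F K α β δ ν r : ℝ} (hA : 0 ≤ A) (hF : 0 ≤ F)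
    (hr : 0 < r) (hmain : A ^ 2 ≤ α * (F * A + β * (B * A)) + 2 * δ ^ 2 * B ^ 2)
    (hen : ν * B ^ 2 ≤ F * A) (h₁ : α * r ≤ K) (h₂ : (α * β) ^ 2 * r ≤ K ^ 2 * ν)
    (h₃ : δ ^ 2 * r ≤ ν) : r * A ≤ (2 * K + K ^ 2 + 4) * F := by
  rcases hA.eq_or_lt with rfl | hA
  · have : 0 ≤ 2 * K + K ^ 2 + 4 := by nlinarith [sq_nonneg (K + 1)]
    rw [mul_zero]
    positivity
  have hFA : 0 ≤ F * A := by positivity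
  have e1 : r * A ^ 2 ≤ α * r * (F * A) + r * (α * β * B * A) + 2 * (δ ^ 2 * r) * B ^ 2 := by
    have := mul_le_mul_of_nonneg_left hmain hr.le
    linarith
  have e2 : α * r * (F * A) ≤ K * (F * A) := mul_le_mul_of_nonneg_right h₁ hFA
  have e3 : (δ ^ 2 * r) * B ^ 2 ≤ F * A :=
    (mul_le_mul_of_nonneg_right h₃ (sq_nonneg B)).trans hen
  have e4 : r * (α * β * B * A) ≤ r * A ^ 2 / 2 + K ^ 2 * (F * A) / 2 := by
    have h5 : (α * β) ^ 2 * r * B ^ 2 ≤ K ^ 2 * (F * A) := by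
      refine (mul_le_mul_of_nonneg_right h₂ (sq_nonneg B)).trans ?_
      rw [mul_assoc]
      exact mul_le_mul_of_nonneg_left hen (sq_nonneg K)
    nlinarith [mul_nonneg hr.le (sq_nonneg (α * β * B - A))]
  have e5 : (r * A) * A ≤ ((2 * K + K ^ 2 + 4) * F) * A := by nlinarith
  exact le_of_mul_le_mul_right e5 hA

/-- The resolvent estimate for smooth functions on a bounded interval. -/
lemma interval_estimate (hG : ∀ x, HasDerivAt G (G₁ x) x) (hG₁ : ∀ x, HasDerivAt G₁ (G₂ x) x)
    (hG₂ : Continuous G₂) {W : ℝ → ℝ} {a l δ ν η K r : ℝ} (N : ℕ) (hl : 0 < l) (hδ : 0 < δ)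
    (hν : 0 < ν) (hη : 0 < η) (hr : 0 < r) (hW : ContinuousOn W (Icc a (a + N * δ)))
    (htile : ∀ t, a ≤ t → t + δ ≤ a + N * δ → ∃ p, t ≤ p ∧ p + l * δ ≤ t + δ ∧
      ((∀ x ∈ Icc p (p + l * δ), η ≤ W x) ∨ ∀ x ∈ Icc p (p + l * δ), η ≤ - W x))
    (ha : G₁ a = 0) (hb : G₁ (a + N * δ) = 0)
    (h₁ : 3 / (l * η) * r ≤ K) (h₂ : (3 / (l * η) * (4 * ν / (l * δ))) ^ 2 * r ≤ K ^ 2 * ν)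
    (h₃ : δ ^ 2 * r ≤ ν) :
    r * √(∫ x in a..a + N * δ, ‖G x‖ ^ 2) ≤ (2 * K + K ^ 2 + 4) *
      √(∫ x in a..a + N * δ, ‖-(ν : ℂ) * G₂ x + Complex.I * W x * G x‖ ^ 2) := by
  have hab : a ≤ a + N * δ := by
    have : 0 ≤ N * δ := by positivity
    linarith
  have cG : Continuous G := continuous_iff_continuousAt.2 fun x => (hG x).continuousAt
  have cG₁ : Continuous G₁ := continuous_iff_continuousAt.2 fun x => (hG₁ x).continuousAt
  have hmain := tiling_estimate hG hG₁ hG₂ N hl hδ hν hη hW htile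
  have hen := energy_estimate hG hG₁ hG₂ (ν := ν) hab hW ha hb
  set f : ℝ → ℂ := fun x => -(ν : ℂ) * G₂ x + Complex.I * W x * G x with hf
  have cf : ContinuousOn f (Icc a (a + N * δ)) := by
    refine (continuous_const.mul hG₂).continuousOn.add ((continuousOn_const.mul ?_).mul
      cG.continuousOn)
    exact Complex.continuous_ofReal.comp_continuousOn hW
  have cs : ∀ {u w : ℝ → ℂ}, ContinuousOn u (Icc a (a + N * δ)) →
      ContinuousOn w (Icc a (a + N * δ)) → ∫ x in a..a + N * δ, ‖u x‖ * ‖w x‖ ≤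
        √(∫ x in a..a + N * δ, ‖u x‖ ^ 2) * √(∫ x in a..a + N * δ, ‖w x‖ ^ 2) := by
    intro u w hu hw
    rw [← Real.sqrt_mul (integral_nonneg hab fun x _ => by positivity)]
    exact Real.le_sqrt_of_sq_le (sq_intervalIntegral_mul_le hab hu.norm hw.norm)
  have sq : ∀ u : ℝ → ℂ, √(∫ x in a..a + N * δ, ‖u x‖ ^ 2) ^ 2 = ∫ x in a..a + N * δ, ‖u x‖ ^ 2 :=
    fun u => Real.sq_sqrt (integral_nonneg hab fun x _ => by positivity)
  refine le_of_quadratic_bounds (B := √(∫ x in a..a + N * δ, ‖G₁ x‖ ^ 2)) (α := 3 / (l * η))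
    (β := 4 * ν / (l * δ)) (δ := δ) (Real.sqrt_nonneg _) (Real.sqrt_nonneg _) hr ?_ ?_ h₁ h₂ h₃
  · rw [sq G, sq G₁]
    refine hmain.trans ?_
    gcongr
    · exact cs cf cG.continuousOn
    · exact cs cG₁.continuousOn cG.continuousOn
  · rw [sq G₁]
    exact hen.trans (cs cf cG.continuousOn)

end LocalEstimate

/-! ### Regularity and vanishing of weak solutions on the line. -/

section WeakSolutions

lemma exists_support_subset_Ioo {E : Type*} [Zero E] {χ : ℝ → E} (hc : HasCompactSupport χ) :
    ∃ R : ℝ, 0 < R ∧ ∀ x, x ∉ Ioo (-R) R → χ x = 0 := by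
  obtain ⟨R, hR, hs⟩ := hc.isCompact.isBounded.subset_ball_lt 0 0
  refine ⟨R, hR, fun x hx => image_eq_zero_of_notMem_tsupport fun h => hx ?_⟩
  have := hs h
  rwa [Real.ball_eq_Ioo, zero_sub, zero_add] at this

lemma integral_eq_intervalIntegral_of_support {E : Type*} [NormedAddCommGroup E] [NormedSpace ℝ E]
    {χ : ℝ → E} {a b : ℝ} (hab : a ≤ b) (h : ∀ x, x ∉ Ioo a b → χ x = 0) :
    ∫ x, χ x = ∫ x in a..b, χ x := by
  rw [intervalIntegral.integral_of_le hab]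
  exact (setIntegral_eq_integral_of_forall_compl_eq_zero fun x hx =>
    h x fun hx' => hx (Ioo_subset_Ioc_self hx')).symm

/-- A test function with vanishing mean is the derivative of a test function. -/
lemma exists_test_primitive {χ : ℝ → ℝ} (hχ : ContDiff ℝ ∞ χ) (hc : HasCompactSupport χ)
    (h0 : ∫ x, χ x = 0) :
    ∃ ψ : ℝ → ℝ, ContDiff ℝ ∞ ψ ∧ HasCompactSupport ψ ∧ deriv ψ = χ := by
  obtain ⟨R, hR, hs⟩ := exists_support_subset_Ioo hc
  have hd : ∀ x, HasDerivAt (fun x => ∫ t in (-R)..x, χ t) (χ x) x := fun x =>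
    intervalIntegral.integral_hasDerivAt_right (hχ.continuous.intervalIntegrable _ _)
      hχ.continuous.stronglyMeasurable.stronglyMeasurableAtFilter hχ.continuous.continuousAt
  have hderiv : deriv (fun x => ∫ t in (-R)..x, χ t) = χ := funext fun x => (hd x).deriv
  refine ⟨_, ?_, ?_, hderiv⟩
  · rw [contDiff_infty_iff_deriv, hderiv]
    exact ⟨fun x => (hd x).differentiableAt, hχ⟩
  · refine HasCompactSupport.intro (isCompact_Icc (a := -R) (b := R)) fun x hx => ?_
    rcases le_or_gt x (-R) with h | h
    · refine (intervalIntegral.integral_congr (g := fun _ => (0 : ℝ)) fun t ht => ?_).trans (by simp)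
      rw [uIcc_of_ge h] at ht
      exact hs t fun h' => by linarith [h'.1, ht.2]
    -- To the right of the support the primitive equals the whole integral of `χ`; this is where the
    -- vanishing mean is needed.
    · have hx' : R < x := by
        by_contra h'
        exact hx ⟨h.le, not_lt.1 h'⟩
      change ∫ t in (-R)..x, χ t = 0
      rw [← integral_eq_intervalIntegral_of_support (by linarith) fun t ht =>
        hs t fun h' => ht ⟨h'.1, h'.2.trans hx'⟩, h0]

lemma exists_test_integral_one :
    ∃ θ : ℝ → ℝ, ContDiff ℝ ∞ θ ∧ HasCompactSupport θ ∧ ∫ x, θ x = 1 := by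
  let b : ContDiffBump (0 : ℝ) := ⟨1, 2, one_pos, one_lt_two⟩
  exact ⟨b.normed volume, b.contDiff_normed, b.hasCompactSupport_normed, b.integral_normed⟩

lemma integrable_test_mul {φ w : ℝ → ℝ} (hφ : Continuous φ) (hc : HasCompactSupport φ)
    (hw : LocallyIntegrable w) : Integrable fun x => φ x * w x := by
  simpa using hw.integrable_smul_left_of_hasCompactSupport hφ hc

lemma intervalIntegrable_of_locallyIntegrable {h : ℝ → ℝ} (hh : LocallyIntegrable h) {a b : ℝ} :
    IntervalIntegrable h volume a b :=
  intervalIntegrable_iff.2 ((hh.integrableOn_isCompact isCompact_uIcc).mono_set uIoc_subset_uIcc)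

/-- The fundamental lemma of du Bois-Reymond. -/
lemma ae_eq_const_of_integral_deriv_mul {w : ℝ → ℝ} (hw : LocallyIntegrable w)
    (h : ∀ φ : ℝ → ℝ, ContDiff ℝ ∞ φ → HasCompactSupport φ → ∫ x, deriv φ x * w x = 0) :
    ∃ A : ℝ, ∀ᵐ x, w x = A := by
  obtain ⟨θ, hθ, hθc, hθ1⟩ := exists_test_integral_one
  refine ⟨∫ x, θ x * w x, ?_⟩
  refine ae_eq_of_integral_contDiff_smul_eq hw (locallyIntegrable_const _) fun χ hχ hχc => ?_
  have hi : Integrable χ := hχ.continuous.integrable_of_hasCompactSupport hχc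
  have hθi : Integrable θ := hθ.continuous.integrable_of_hasCompactSupport hθc
  set a := ∫ x, χ x with ha
  -- Subtracting `a * θ` removes the mean. Testing against the primitive then gives `∫ χ w = (∫ χ)
  -- (∫ θ w)`, so the constant is `∫ θ w`.
  obtain ⟨ψ, hψ, hψc, hψd⟩ := exists_test_primitive (χ := fun x => χ x - a * θ x)
    (hχ.sub (contDiff_const.mul hθ)) (hχc.sub hθc.mul_left) (by
      rw [integral_sub hi (hθi.const_mul a), integral_const_mul, hθ1, mul_one, sub_self])
  have := h ψ hψ hψc
  rw [hψd] at this
  simp_rw [sub_mul, mul_assoc] at this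
  rw [integral_sub (integrable_test_mul hχ.continuous hχc hw)
    ((integrable_test_mul hθ.continuous hθc hw).const_mul a), integral_const_mul] at this
  simp_rw [smul_eq_mul]
  rw [integral_mul_const]
  linarith

lemma integral_deriv_mul_id {χ : ℝ → ℝ} (hχ : ContDiff ℝ ∞ χ) (hc : HasCompactSupport χ) :
    ∫ x, deriv χ x * x = - ∫ x, χ x := by
  have c' : Continuous (deriv χ) := hχ.continuous_deriv (by simp)
  have := integral_mul_deriv_eq_deriv_mul_of_integrable (u := fun x : ℝ => x) (v := χ)
    (u' := fun _ => 1) (v' := deriv χ) (fun x _ => hasDerivAt_id x)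
    (fun x _ => (hχ.differentiable (by simp) x).hasDerivAt)
    ((continuous_id.mul c').integrable_of_hasCompactSupport hc.deriv.mul_left)
    ((continuous_const.mul hχ.continuous).integrable_of_hasCompactSupport hc.mul_left)
    ((continuous_id.mul hχ.continuous).integrable_of_hasCompactSupport hc.mul_left)
  simp only [one_mul] at this
  rw [← this]
  exact integral_congr_ae (ae_of_all _ fun x => mul_comm _ _)

/-- The hypothesis, tested on the primitive of `χ - (∫ χ) θ`, gives `∫ χ' w = b ∫ χ` with `b = ∫ θ'
w`. Since `∫ χ' x = -∫ χ`, the function `w + b x` has zero weak derivative, and du Bois-Reymond's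
lemma applies to it. -/
lemma ae_eq_affine_of_integral_deriv_deriv_mul {w : ℝ → ℝ} (hw : LocallyIntegrable w)
    (h : ∀ φ : ℝ → ℝ, ContDiff ℝ ∞ φ → HasCompactSupport φ → ∫ x, deriv (deriv φ) x * w x = 0) :
    ∃ A B : ℝ, ∀ᵐ x, w x = A + B * x := by
  obtain ⟨θ, hθ, hθc, hθ1⟩ := exists_test_integral_one
  have hθi : Integrable θ := hθ.continuous.integrable_of_hasCompactSupport hθc
  have cθ' : Continuous (deriv θ) := hθ.continuous_deriv (by simp)
  set b := ∫ x, deriv θ x * w x with hb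
  have hid : LocallyIntegrable fun x : ℝ => b * x :=
    (continuous_const.mul continuous_id).locallyIntegrable
  obtain ⟨A, hA⟩ := ae_eq_const_of_integral_deriv_mul (w := fun x => w x + b * x) (hw.add hid) (by
    intro χ hχ hχc
    have hi : Integrable χ := hχ.continuous.integrable_of_hasCompactSupport hχc
    have cχ' : Continuous (deriv χ) := hχ.continuous_deriv (by simp)
    set a := ∫ x, χ x with ha
    obtain ⟨ψ, hψ, hψc, hψd⟩ := exists_test_primitive (χ := fun x => χ x - a * θ x)
      (hχ.sub (contDiff_const.mul hθ)) (hχc.sub hθc.mul_left) (by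
        rw [integral_sub hi (hθi.const_mul a), integral_const_mul, hθ1, mul_one, sub_self])
    have h1 := h ψ hψ hψc
    have hd : deriv (deriv ψ) = fun x => deriv χ x - a * deriv θ x := by
      rw [hψd]
      funext x
      exact (((hχ.differentiable (by simp) x).hasDerivAt).sub
        (((hθ.differentiable (by simp) x).hasDerivAt).const_mul a)).deriv
    rw [hd] at h1
    simp_rw [sub_mul, mul_assoc] at h1
    rw [integral_sub (integrable_test_mul cχ' hχc.deriv hw)
      ((integrable_test_mul cθ' hθc.deriv hw).const_mul a), integral_const_mul] at h1
    simp_rw [mul_add]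
    rw [integral_add (integrable_test_mul cχ' hχc.deriv hw)
      (integrable_test_mul cχ' hχc.deriv hid)]
    have h2 : ∫ x, deriv χ x * (b * x) = b * ∫ x, deriv χ x * x := by
      rw [← integral_const_mul]
      exact integral_congr_ae (ae_of_all _ fun x => by ring)
    rw [h2, integral_deriv_mul_id hχ hχc]
    linarith)
  refine ⟨A, -b, ?_⟩
  filter_upwards [hA] with x hx
  linarith

/-- A locally integrable function is the weak derivative of its primitive. -/
lemma integral_deriv_mul_primitive {h φ : ℝ → ℝ} (hh : LocallyIntegrable h)
    (hφ : ContDiff ℝ ∞ φ) (hc : HasCompactSupport φ) (c : ℝ) :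
    ∫ x, deriv φ x * (c + ∫ t in (0 : ℝ)..x, h t) = - ∫ x, φ x * h x := by
  obtain ⟨R, hR, hs⟩ := exists_support_subset_Ioo hc
  obtain ⟨R', hR', hs'⟩ := exists_support_subset_Ioo hc.deriv
  set ρ := max R R' with hρ
  have hρR : R ≤ ρ := le_max_left _ _
  have hρR' : R' ≤ ρ := le_max_right _ _
  have hρ0 : 0 < ρ := hR.trans_le hρR
  have z : ∀ x, x ∉ Ioo (-ρ) ρ → φ x = 0 := fun x hx =>
    hs x fun h' => hx ⟨by linarith [h'.1], by linarith [h'.2]⟩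
  have z' : ∀ x, x ∉ Ioo (-ρ) ρ → deriv φ x = 0 := fun x hx =>
    hs' x fun h' => hx ⟨by linarith [h'.1], by linarith [h'.2]⟩
  rw [integral_eq_intervalIntegral_of_support (a := -ρ) (b := ρ) (by linarith)
      fun x hx => by rw [z' x hx, zero_mul],
    integral_eq_intervalIntegral_of_support (a := -ρ) (b := ρ) (by linarith)
      fun x hx => by rw [z x hx, zero_mul]]
  have hint : IntervalIntegrable h volume (-ρ) ρ :=
    intervalIntegrable_of_locallyIntegrable hh
  have h0 : (0 : ℝ) ∈ uIcc (-ρ) ρ := by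
    rw [uIcc_of_le (by linarith)]
    exact ⟨by linarith, hρ0.le⟩
  -- As `h` is merely locally integrable, its primitive is differentiable only almost everywhere;
  -- integration by parts goes through absolute continuity.
  have acP := hint.absolutelyContinuousOnInterval_intervalIntegral h0
  have acc : AbsolutelyContinuousOnInterval (fun _ : ℝ => c) (-ρ) ρ :=
    (contDiff_const (n := 1)).contDiffOn.absolutelyContinuousOnInterval
  have acφ : AbsolutelyContinuousOnInterval φ (-ρ) ρ :=
    (hφ.of_le (by simp)).contDiffOn.absolutelyContinuousOnInterval
  have := acφ.integral_mul_deriv_eq_deriv_mul (acc.add acP)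
  rw [z ρ (by simp), z (-ρ) (by simp)] at this
  have e : ∫ x in (-ρ)..ρ, φ x * deriv ((fun _ : ℝ => c) + fun x => ∫ t in (0 : ℝ)..x, h t) x
      = ∫ x in (-ρ)..ρ, φ x * h x := by
    refine intervalIntegral.integral_congr_ae ?_
    filter_upwards [hint.ae_hasDerivAt_integral] with x hx hx'
    have := (hx (uIoc_subset_uIcc hx') 0 h0).const_add c
    rw [show ((fun _ : ℝ => c) + fun x => ∫ t in (0 : ℝ)..x, h t) =
      fun x => c + ∫ t in (0 : ℝ)..x, h t from rfl, this.deriv]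
  rw [e] at this
  simp only [Pi.add_apply] at this
  linarith

/-- Regularity of weak solutions of `f'' = h`. -/
lemma ae_eq_of_weak_second_deriv {f h : ℝ → ℝ} (hf : LocallyIntegrable f)
    (hh : LocallyIntegrable h)
    (hw : ∀ φ : ℝ → ℝ, ContDiff ℝ ∞ φ → HasCompactSupport φ →
      ∫ x, deriv (deriv φ) x * f x = ∫ x, φ x * h x) :
    ∃ A B : ℝ, ∀ᵐ x, f x = A + ∫ t in (0 : ℝ)..x, (B + ∫ s in (0 : ℝ)..t, h s) := by
  have cP : Continuous fun t => ∫ s in (0 : ℝ)..t, h s :=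
    intervalIntegral.continuous_primitive (fun a b => intervalIntegrable_of_locallyIntegrable hh) 0
  have cF : Continuous fun x => ∫ t in (0 : ℝ)..x, ∫ s in (0 : ℝ)..t, h s :=
    intervalIntegral.continuous_primitive (fun a b => cP.intervalIntegrable a b) 0
  -- Subtracting the double primitive of `h` leaves a function with zero second weak derivative.
  obtain ⟨A, B, hAB⟩ := ae_eq_affine_of_integral_deriv_deriv_mul
    (w := fun x => f x - ∫ t in (0 : ℝ)..x, ∫ s in (0 : ℝ)..t, h s)
    (hf.sub cF.locallyIntegrable) (by
      intro φ hφ hc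
      have hφ' : ContDiff ℝ ∞ (deriv φ) := (contDiff_infty_iff_deriv.1 hφ).2
      have c'' : Continuous (deriv (deriv φ)) := hφ'.continuous_deriv (by simp)
      simp_rw [mul_sub]
      rw [integral_sub (integrable_test_mul c'' hc.deriv.deriv hf)
        (integrable_test_mul c'' hc.deriv.deriv cF.locallyIntegrable), hw φ hφ hc]
      have h1 := integral_deriv_mul_primitive cP.locallyIntegrable hφ' hc.deriv 0
      have h2 := integral_deriv_mul_primitive hh hφ hc 0
      simp only [zero_add] at h1 h2
      rw [h1, h2]
      ring)
  refine ⟨A, B, ?_⟩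
  filter_upwards [hAB] with x hx
  rw [intervalIntegral.integral_add (continuous_const.intervalIntegrable _ _)
    (cP.intervalIntegrable _ _), intervalIntegral.integral_const, smul_eq_mul]
  linarith

/-- Convexity bounds `N x` by the mean of `N (x + t)` and `N (x - t)`, which is integrable in `t`.
The constant `N x` is therefore integrable over the whole line. -/
lemma eq_zero_of_convex_integrable {N : ℝ → ℝ} (hN : ConvexOn ℝ univ N) (h0 : ∀ x, 0 ≤ N x)
    (hi : Integrable N) (x : ℝ) : N x = 0 := by
  have h1 : Integrable fun t => (1 / 2 : ℝ) * N (x + t) + (1 / 2 : ℝ) * N (x - t) :=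
    ((hi.comp_add_left x).const_mul _).add ((hi.comp_sub_left x).const_mul _)
  have h2 : Integrable fun _ : ℝ => N x := by
    refine h1.mono' aestronglyMeasurable_const (ae_of_all _ fun t => ?_)
    rw [Real.norm_of_nonneg (h0 x)]
    have := hN.2 (mem_univ (x + t)) (mem_univ (x - t)) (by norm_num : (0 : ℝ) ≤ 1 / 2)
      (by norm_num : (0 : ℝ) ≤ 1 / 2) (by norm_num)
    simp only [smul_eq_mul] at this
    rwa [show (1 / 2 : ℝ) * (x + t) + 1 / 2 * (x - t) = x by ring] at this
  rcases (integrable_const_iff).1 h2 with h | h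
  · exact h
  · exact absurd h.measure_univ_lt_top (by simp)

/-- The equation `f'' = i Q f` with real continuous `Q` has no nonzero weak solution in `L²(ℝ)`. -/
lemma ae_eq_zero_of_weak_solution {f : ℝ → ℂ} (hf : MemLp f 2) {Q : ℝ → ℝ} (hQ : Continuous Q)
    (hw : ∀ φ : ℝ → ℝ, ContDiff ℝ ∞ φ → HasCompactSupport φ →
      ∫ x, deriv (deriv φ) x • f x = ∫ x, φ x • (Complex.I * Q x * f x)) :
    ∀ᵐ x, f x = 0 := by
  have hloc : LocallyIntegrable f := hf.locallyIntegrable (by norm_num)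
  have hre : LocallyIntegrable fun x => (f x).re := fun x =>
    (hloc x).imp fun s hs => ⟨hs.1, hs.2.re⟩
  have him : LocallyIntegrable fun x => (f x).im := fun x =>
    (hloc x).imp fun s hs => ⟨hs.1, hs.2.im⟩
  have hQre : LocallyIntegrable fun x => Q x * (f x).re := by
    exact hre.continuous_mul hQ
  have hQim : LocallyIntegrable fun x => -(Q x * (f x).im) := by
    have : LocallyIntegrable fun x => Q x * (f x).im := by
      exact him.continuous_mul hQ
    exact this.neg
  have hQf : LocallyIntegrable fun x => Complex.I * Q x * f x := by
    refine hloc.continuous_mul (g := fun x => Complex.I * (Q x : ℂ)) ?_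
    fun_prop
  -- Real test functions split the equation into a coupled real system for the real and imaginary
  -- parts.
  have hw' : ∀ φ : ℝ → ℝ, ContDiff ℝ ∞ φ → HasCompactSupport φ →
      (∫ x, deriv (deriv φ) x * (f x).re = ∫ x, φ x * -(Q x * (f x).im)) ∧
      ∫ x, deriv (deriv φ) x * (f x).im = ∫ x, φ x * (Q x * (f x).re) := by
    intro φ hφ hc
    have hφ' : ContDiff ℝ ∞ (deriv φ) := (contDiff_infty_iff_deriv.1 hφ).2
    have c'' : Continuous (deriv (deriv φ)) := hφ'.continuous_deriv (by simp)
    have i1 := hloc.integrable_smul_left_of_hasCompactSupport c'' hc.deriv.deriv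
    have i2 := hQf.integrable_smul_left_of_hasCompactSupport hφ.continuous hc
    constructor
    · have := congrArg Complex.reCLM (hw φ hφ hc)
      rw [← Complex.reCLM.integral_comp_comm i1, ← Complex.reCLM.integral_comp_comm i2] at this
      simpa using this
    · have := congrArg Complex.imCLM (hw φ hφ hc)
      rw [← Complex.imCLM.integral_comp_comm i1, ← Complex.imCLM.integral_comp_comm i2] at this
      simpa using this
  obtain ⟨A₁, B₁, h₁⟩ := ae_eq_of_weak_second_deriv hre hQim fun φ hφ hc => (hw' φ hφ hc).1
  obtain ⟨A₂, B₂, h₂⟩ := ae_eq_of_weak_second_deriv him hQre fun φ hφ hc => (hw' φ hφ hc).2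
  have cprim : ∀ {h : ℝ → ℝ} (B : ℝ), LocallyIntegrable h →
      Continuous fun t => B + ∫ s in (0 : ℝ)..t, h s := fun B hh =>
    continuous_const.add (intervalIntegral.continuous_primitive
      (fun a b => intervalIntegrable_of_locallyIntegrable hh) 0)
  have dprim : ∀ {h : ℝ → ℝ} (B : ℝ), Continuous h → ∀ x,
      HasDerivAt (fun t => B + ∫ s in (0 : ℝ)..t, h s) (h x) x := fun B hh x =>
    (intervalIntegral.integral_hasDerivAt_right (hh.intervalIntegrable _ _)
      hh.stronglyMeasurable.stronglyMeasurableAtFilter hh.continuousAt).const_add B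
  set D₁ : ℝ → ℝ := fun t => B₁ + ∫ s in (0 : ℝ)..t, -(Q s * (f s).im) with hD₁
  set D₂ : ℝ → ℝ := fun t => B₂ + ∫ s in (0 : ℝ)..t, Q s * (f s).re with hD₂
  have cD₁ : Continuous D₁ := cprim B₁ hQim
  have cD₂ : Continuous D₂ := cprim B₂ hQre
  set F₁ : ℝ → ℝ := fun x => A₁ + ∫ t in (0 : ℝ)..x, D₁ t with hF₁
  set F₂ : ℝ → ℝ := fun x => A₂ + ∫ t in (0 : ℝ)..x, D₂ t with hF₂
  have dF₁ : ∀ x, HasDerivAt F₁ (D₁ x) x := dprim A₁ cD₁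
  have dF₂ : ∀ x, HasDerivAt F₂ (D₂ x) x := dprim A₂ cD₂
  have cF₁ : Continuous F₁ := continuous_iff_continuousAt.2 fun x => (dF₁ x).continuousAt
  have cF₂ : Continuous F₂ := continuous_iff_continuousAt.2 fun x => (dF₂ x).continuousAt
  -- Bootstrap: `f` enters `D₁` only under an integral, so it may be replaced by its continuous
  -- representative, which makes `D₁` differentiable everywhere.
  have eD₁ : D₁ = fun t => B₁ + ∫ s in (0 : ℝ)..t, -(Q s * F₂ s) := by
    funext t
    refine congrArg (B₁ + ·) ?_
    refine intervalIntegral.integral_congr_ae ?_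
    filter_upwards [h₂] with s hs _
    rw [hs]
  have eD₂ : D₂ = fun t => B₂ + ∫ s in (0 : ℝ)..t, Q s * F₁ s := by
    funext t
    refine congrArg (B₂ + ·) ?_
    refine intervalIntegral.integral_congr_ae ?_
    filter_upwards [h₁] with s hs _
    rw [hs]
  have dD₁ : ∀ x, HasDerivAt D₁ (-(Q x * F₂ x)) x := by
    rw [eD₁]
    exact dprim B₁ (hQ.mul cF₂).neg
  have dD₂ : ∀ x, HasDerivAt D₂ (Q x * F₁ x) x := by
    rw [eD₂]
    exact dprim B₂ (hQ.mul cF₁)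
  set N : ℝ → ℝ := fun x => F₁ x ^ 2 + F₂ x ^ 2 with hN
  set N' : ℝ → ℝ := fun x => 2 * (F₁ x * D₁ x + F₂ x * D₂ x) with hN'
  have dN : ∀ x, HasDerivAt N (N' x) x := fun x => by
    refine (((dF₁ x).pow 2).add ((dF₂ x).pow 2)).congr_deriv ?_
    simp only [hN']
    push_cast
    ring
  -- The two `Q F₁ F₂` terms cancel because the coefficient `i Q` is purely imaginary; only the
  -- square of the derivative remains.
  have dN' : ∀ x, HasDerivAt N' (2 * (D₁ x ^ 2 + D₂ x ^ 2)) x := fun x => by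
    refine ((((dF₁ x).mul (dD₁ x)).add ((dF₂ x).mul (dD₂ x))).const_mul 2).congr_deriv ?_
    ring
  have eN : deriv N = N' := funext fun x => (dN x).deriv
  have hconv : ConvexOn ℝ univ N := by
    refine Monotone.convexOn_univ_of_deriv (fun x => (dN x).differentiableAt) ?_
    rw [eN]
    refine monotone_of_deriv_nonneg (fun x => (dN' x).differentiableAt) fun x => ?_
    rw [(dN' x).deriv]
    positivity
  have hint : Integrable N := by
    refine (hf.integrable_norm_pow (by norm_num)).congr ?_
    filter_upwards [h₁, h₂] with x hx₁ hx₂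
    change ‖f x‖ ^ 2 = F₁ x ^ 2 + F₂ x ^ 2
    rw [← Complex.normSq_eq_norm_sq, Complex.normSq_apply, hx₁, hx₂]
    ring
  filter_upwards [h₁, h₂] with x hx₁ hx₂
  have h0 : F₁ x ^ 2 + F₂ x ^ 2 = 0 :=
    eq_zero_of_convex_integrable hconv (fun x => by positivity) hint x
  have z₁ : F₁ x = 0 := by nlinarith [sq_nonneg (F₁ x), sq_nonneg (F₂ x)]
  have z₂ : F₂ x = 0 := by nlinarith [sq_nonneg (F₁ x), sq_nonneg (F₂ x)]
  exact Complex.ext (hx₁.trans z₁) (hx₂.trans z₂)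

end WeakSolutions

/-! ### Neumann test functions, half-lines and even reflection. -/

section NeumannTest

/-- Smooth compactly supported functions on the line satisfying the Neumann condition
on `∂Ω`. -/
structure IsNeumannTest {E : Type*} [NormedAddCommGroup E] [NormedSpace ℝ E] (Ω : Opens ℝ)
    (G : ℝ → E) : Prop where
  contDiff : ContDiff ℝ ∞ G
  hasCompactSupport : HasCompactSupport G
  deriv_eq_zero : ∀ y ∈ frontier (Ω : Set ℝ), deriv G y = 0

/-- `Ω` is the half-line with endpoint `L` in the direction `s = ±1`. -/
structure IsHalfLine (Ω : Opens ℝ) (s L : ℝ) : Prop where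
  sign : s = 1 ∨ s = -1
  coe_eq : (Ω : Set ℝ) = {x | 0 < s * (x - L)}

lemma eq_univ_or_isHalfLine {Ω : Opens ℝ} (hΩ : (Ω : Set ℝ) = univ ∨
    (∃ L₁ : ℝ, (Ω : Set ℝ) = Iio L₁) ∨ ∃ L₂ : ℝ, (Ω : Set ℝ) = Ioi L₂) :
    (Ω : Set ℝ) = univ ∨ ∃ s L, IsHalfLine Ω s L := by
  rcases hΩ with h | ⟨L, h⟩ | ⟨L, h⟩
  · exact Or.inl h
  · refine Or.inr ⟨-1, L, Or.inr rfl, h.trans ?_⟩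
    ext x
    simp
  · refine Or.inr ⟨1, L, Or.inl rfl, h.trans ?_⟩
    ext x
    simp

namespace IsHalfLine

variable {Ω : Opens ℝ} {s L : ℝ}

lemma mul_self (h : IsHalfLine Ω s L) : s * s = 1 := by
  rcases h.sign with rfl | rfl <;> norm_num

lemma abs_eq (h : IsHalfLine Ω s L) : |s| = 1 := by
  rcases h.sign with rfl | rfl <;> norm_num

lemma mem_iff (h : IsHalfLine Ω s L) {x : ℝ} : x ∈ (Ω : Set ℝ) ↔ 0 < s * (x - L) := by
  rw [h.coe_eq, mem_ofPred_eq]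

lemma eq_Ioi_or_Iio (h : IsHalfLine Ω s L) :
    (s = 1 ∧ (Ω : Set ℝ) = Ioi L) ∨ (s = -1 ∧ (Ω : Set ℝ) = Iio L) := by
  have h' := h.coe_eq
  rcases h.sign with rfl | rfl
  · refine Or.inl ⟨rfl, h'.trans ?_⟩
    ext x
    simp
  · refine Or.inr ⟨rfl, h'.trans ?_⟩
    ext x
    simp

lemma mem_closure_iff (h : IsHalfLine Ω s L) {x : ℝ} :
    x ∈ closure (Ω : Set ℝ) ↔ 0 ≤ s * (x - L) := by
  rcases h.eq_Ioi_or_Iio with ⟨rfl, e⟩ | ⟨rfl, e⟩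
  · rw [e, closure_Ioi, mem_Ici]
    constructor <;> intro <;> linarith
  · rw [e, closure_Iio, mem_Iic]
    constructor <;> intro <;> linarith

lemma frontier_eq (h : IsHalfLine Ω s L) : frontier (Ω : Set ℝ) = {L} := by
  rcases h.eq_Ioi_or_Iio with ⟨rfl, e⟩ | ⟨rfl, e⟩
  · rw [e, frontier_Ioi]
  · rw [e, frontier_Iio]

end IsHalfLine

lemma uniqueDiffOn_closure {Ω : Opens ℝ}
    (hΩ : (Ω : Set ℝ) = univ ∨ ∃ s L, IsHalfLine Ω s L) :
    UniqueDiffOn ℝ (closure (Ω : Set ℝ)) := by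
  rcases hΩ with h | ⟨s, L, h⟩
  · rw [h, closure_univ]
    exact uniqueDiffOn_univ
  · rcases h.eq_Ioi_or_Iio with ⟨-, e⟩ | ⟨-, e⟩
    · rw [e, closure_Ioi]
      exact uniqueDiffOn_Ici L
    · rw [e, closure_Iio]
      exact uniqueDiffOn_Iic L

/-- A weak solution of `f'' = i Q f` in `L²(Ω)` with Neumann conditions vanishes. -/
lemma eq_zero_of_weak_neumann_solution {Ω : Opens ℝ}
    (hΩ : (Ω : Set ℝ) = univ ∨ ∃ s L, IsHalfLine Ω s L) (f : X Ω) {Q : ℝ → ℝ}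
    (hQ : ContinuousOn Q (closure (Ω : Set ℝ)))
    (hw : ∀ φ : ℝ → ℝ, IsNeumannTest Ω φ → ∫ x in (Ω : Set ℝ), deriv (deriv φ) x • f x =
      ∫ x in (Ω : Set ℝ), φ x • (Complex.I * Q x * f x)) : f = 0 := by
  suffices h : ∀ᵐ x ∂(volume.restrict (Ω : Set ℝ)), f x = 0 by
    refine Lp.ext ?_
    filter_upwards [h, Lp.coeFn_zero ℂ 2 (volume.restrict (Ω : Set ℝ))] with x h1 h2
    rw [h1, h2, Pi.zero_apply]
  have hfm : MemLp f 2 (volume.restrict (Ω : Set ℝ)) := Lp.memLp f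
  rcases hΩ with hΩ | ⟨s, L, hΩ⟩
  · rw [hΩ, closure_univ] at hQ
    simp only [hΩ, Measure.restrict_univ] at hw hfm ⊢
    refine ae_eq_zero_of_weak_solution hfm (continuousOn_univ.1 hQ) fun φ hφ hc =>
      hw φ ⟨hφ, hc, ?_⟩
    simp [hΩ]
  · have hmeas : MeasurableSet (Ω : Set ℝ) := Ω.isOpen.measurableSet
    -- With `F` the extension by zero and `τ` the reflection about `L`, the function `F + F ∘ τ` is
    -- the even extension of `f`.
    set F : ℝ → ℂ := (Ω : Set ℝ).indicator f with hF
    have hFm : MemLp F 2 := (memLp_indicator_iff_restrict hmeas).2 hfm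
    set τ : ℝ → ℝ := fun x => 2 * L - x with hτ
    have hτm : MeasurePreserving τ := Measure.measurePreserving_sub_left volume (2 * L)
    have hFτ : MemLp (F ∘ τ) 2 := hFm.comp_measurePreserving hτm
    -- `ρ` folds the line onto the closure of `Ω`, so `Q ∘ ρ` is a continuous even extension of `Q`.
    set ρ : ℝ → ℝ := fun x => L + s * |x - L| with hρ
    have hss := hΩ.mul_self
    have hρcl : ∀ x, ρ x ∈ closure (Ω : Set ℝ) := fun x => by
      rw [hΩ.mem_closure_iff, hρ, show s * (L + s * |x - L| - L) = s * s * |x - L| by ring, hss]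
      positivity
    have hρΩ : ∀ x ∈ (Ω : Set ℝ), ρ x = x := fun x hx => by
      have h0 := hΩ.mem_iff.1 hx
      have : |x - L| = s * (x - L) := by
        rw [← abs_of_pos h0, abs_mul, hΩ.abs_eq, one_mul]
      rw [hρ]
      simp only
      rw [this, ← mul_assoc, hss]
      ring
    have hρτ : ∀ x, ρ (τ x) = ρ x := fun x => by
      simp only [hρ, hτ]
      rw [show 2 * L - x - L = -(x - L) by ring, abs_neg]
    have hρc : Continuous ρ := by fun_prop
    set P : ℝ → ℝ := fun x => Q (ρ x) with hP
    have hPc : Continuous P := hQ.comp_continuous hρc hρcl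
    have hPF : ∀ x, (P x : ℂ) * F x = (Ω : Set ℝ).indicator (fun x => (Q x : ℂ) * f x) x := by
      intro x
      by_cases hx : x ∈ (Ω : Set ℝ)
      · rw [hF, indicator_of_mem hx, indicator_of_mem hx, hP]
        simp only
        rw [hρΩ x hx]
      · rw [hF, indicator_of_notMem hx, indicator_of_notMem hx, mul_zero]
    have hPτ : ∀ x, P (τ x) = P x := fun x => by simp only [hP]; rw [hρτ]
    have hmain : ∀ᵐ x, (F + F ∘ τ) x = 0 := by
      refine ae_eq_zero_of_weak_solution (hFm.add hFτ) hPc fun φ hφ hc => ?_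
      have hφ' : ContDiff ℝ ∞ (deriv φ) := (contDiff_infty_iff_deriv.1 hφ).2
      have c'' : Continuous (deriv (deriv φ)) := hφ'.continuous_deriv (by simp)
      have hτd : ∀ x, HasDerivAt τ (-1) x := fun x => (hasDerivAt_id x).const_sub (2 * L)
      have hd : ∀ {ψ : ℝ → ℝ}, ContDiff ℝ ∞ ψ → ∀ x,
          HasDerivAt (fun x => ψ (τ x)) (-deriv ψ (τ x)) x := fun hψ x => by
        have := ((hψ.differentiable (by simp) (τ x)).hasDerivAt).comp x (hτd x)
        exact this.congr_deriv (by ring)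
      -- Symmetrizing an arbitrary test function makes its derivative vanish at `L`, hence makes it
      -- admissible in `hw`. The identity `split` below moves the reflection from the function to
      -- the test function.
      set χ : ℝ → ℝ := fun x => φ x + φ (τ x) with hχ
      have hχ' : deriv χ = fun x => deriv φ x - deriv φ (τ x) := funext fun x => by
        have := ((hφ.differentiable (by simp) x).hasDerivAt).add (hd hφ x)
        rw [← sub_eq_add_neg] at this
        exact this.deriv
      have hχ'' : deriv (deriv χ) = fun x => deriv (deriv φ) x + deriv (deriv φ) (τ x) := by
        rw [hχ']
        funext x
        have := ((hφ'.differentiable (by simp) x).hasDerivAt).sub (hd hφ' x)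
        rw [sub_neg_eq_add] at this
        exact this.deriv
      have hτs : ContDiff ℝ ∞ τ := contDiff_const.sub contDiff_id
      have hτe : Topology.IsClosedEmbedding τ :=
        (Homeomorph.subLeft (2 * L)).isClosedEmbedding
      have hχt : IsNeumannTest Ω χ := by
        refine ⟨hφ.add (hφ.comp hτs), hc.add (hc.comp_isClosedEmbedding hτe), fun y hy => ?_⟩
        rw [hΩ.frontier_eq, mem_singleton_iff] at hy
        rw [hχ', hy]
        simp only [hτ]
        rw [show 2 * L - L = L by ring, sub_self]
      have key := hw χ hχt
      rw [hχ''] at key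
      have split : ∀ {ψ : ℝ → ℝ} {g : ℝ → ℂ}, Continuous ψ → HasCompactSupport ψ →
          LocallyIntegrable g → LocallyIntegrable (g ∘ τ) →
          ∫ x, ψ x • (g x + g (τ x)) = ∫ x, (ψ x + ψ (τ x)) • g x := by
        intro ψ g hψ hψc hg hgτ
        have hψτ : HasCompactSupport (ψ ∘ τ) := hψc.comp_isClosedEmbedding hτe
        have cψτ : Continuous (ψ ∘ τ) := hψ.comp hτs.continuous
        have i1 := hg.integrable_smul_left_of_hasCompactSupport hψ hψc
        have i2 : Integrable fun x => ψ x • g (τ x) := hgτ.integrable_smul_left_of_hasCompactSupport hψ hψc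
        have i3 : Integrable fun x => ψ (τ x) • g x := hg.integrable_smul_left_of_hasCompactSupport cψτ hψτ
        simp_rw [smul_add, add_smul]
        rw [integral_add i1 i2, integral_add i1 i3]
        congr 1
        rw [← integral_sub_left_eq_self (fun x => ψ (τ x) • g x) volume (2 * L)]
        refine integral_congr_ae (ae_of_all _ fun x => ?_)
        simp [hτ]
      have toΩ : ∀ (ψ : ℝ → ℝ) (g : ℝ → ℂ),
          ∫ x, ψ x • (Ω : Set ℝ).indicator g x = ∫ x in (Ω : Set ℝ), ψ x • g x := by
        intro ψ g
        rw [← integral_indicator hmeas]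
        refine integral_congr_ae (ae_of_all _ fun x => ?_)
        exact (indicator_smul_apply _ ψ g x).symm
      have lF : LocallyIntegrable F := hFm.locallyIntegrable (by norm_num)
      have lFτ : LocallyIntegrable (F ∘ τ) := hFτ.locallyIntegrable (by norm_num)
      have cIP : Continuous fun x => Complex.I * (P x : ℂ) := by fun_prop
      have lPF : LocallyIntegrable fun x => Complex.I * P x * F x := lF.continuous_mul cIP
      have lPFτ : LocallyIntegrable ((fun x => Complex.I * P x * F x) ∘ τ) := by
        have := lFτ.continuous_mul cIP
        refine this.congr (ae_of_all _ fun x => ?_)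
        simp [hPτ]
      have e1 := split c'' hc.deriv.deriv lF lFτ
      have e2 := split hφ.continuous hc lPF lPFτ
      calc ∫ x, deriv (deriv φ) x • (F + F ∘ τ) x
          = ∫ x, (deriv (deriv φ) x + deriv (deriv φ) (τ x)) • F x := e1
        _ = ∫ x, χ x • (Complex.I * P x * F x) := by
          rw [hF, toΩ, key, ← toΩ]
          refine integral_congr_ae (ae_of_all _ fun x => ?_)
          simp only
          rw [mul_assoc, ← hF, hPF]
          congr 1
          by_cases hx : x ∈ (Ω : Set ℝ)
          · simp [hx, mul_assoc]
          · simp [hx]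
        _ = ∫ x, φ x • (Complex.I * P x * (F + F ∘ τ) x) := by
          rw [← e2]
          refine integral_congr_ae (ae_of_all _ fun x => ?_)
          simp only [Pi.add_apply, Function.comp_apply, hPτ, mul_add]
    rw [ae_restrict_iff' hmeas]
    filter_upwards [hmain] with x hx hxΩ
    have hτx : τ x ∉ (Ω : Set ℝ) := by
      rw [hΩ.mem_iff, not_lt, hτ]
      have := hΩ.mem_iff.1 hxΩ
      nlinarith
    simpa [hF, hxΩ, hτx] using hx

end NeumannTest

/-! ### Integration by parts up to the boundary and Green's formula. -/

section BoundaryIntegration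

lemma deriv_smoothTransition_eq_zero {x : ℝ} (hx : x ∉ Icc (0 : ℝ) 1) :
    deriv Real.smoothTransition x = 0 := by
  rcases lt_or_ge x 0 with h | h
  · have : Real.smoothTransition =ᶠ[𝓝 x] fun _ => 0 := by
      filter_upwards [Iio_mem_nhds h] with y hy
      exact Real.smoothTransition.zero_of_nonpos (le_of_lt hy)
    rw [this.deriv_eq, deriv_const]
  · have h1 : 1 < x := by
      by_contra h'
      exact hx ⟨h, not_lt.1 h'⟩
    have : Real.smoothTransition =ᶠ[𝓝 x] fun _ => 1 := by
      filter_upwards [Ioi_mem_nhds h1] with y hy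
      exact Real.smoothTransition.one_of_one_le (le_of_lt hy)
    rw [this.deriv_eq, deriv_const]

lemma exists_bound_deriv_smoothTransition :
    ∃ C : ℝ, 0 ≤ C ∧ ∀ x, |deriv Real.smoothTransition x| ≤ C := by
  have c : Continuous (deriv Real.smoothTransition) :=
    (Real.smoothTransition.contDiff (n := 1)).continuous_deriv (by simp)
  obtain ⟨C, hC⟩ := (isCompact_Icc (a := (0 : ℝ)) (b := 1)).exists_bound_of_continuousOn
    c.continuousOn
  refine ⟨C, (norm_nonneg _).trans (hC 0 (by simp)), fun x => ?_⟩
  by_cases hx : x ∈ Icc (0 : ℝ) 1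
  · exact hC x hx
  · rw [deriv_smoothTransition_eq_zero hx, abs_zero]
    exact (norm_nonneg _).trans (hC 0 (by simp))

/-- Cutoff away from the endpoint of a half-line. -/
def cutoff (s L : ℝ) (n : ℕ) (x : ℝ) : ℝ := Real.smoothTransition (n * (s * (x - L)) - 1)

/-- The derivative of `cutoff`. -/
def cutoffDeriv (s L : ℝ) (n : ℕ) (x : ℝ) : ℝ :=
  deriv Real.smoothTransition (n * (s * (x - L)) - 1) * (n * s)

lemma contDiff_cutoff (s L : ℝ) (n : ℕ) : ContDiff ℝ ∞ (cutoff s L n) := by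
  have : ContDiff ℝ ∞ fun x : ℝ => (n : ℝ) * (s * (x - L)) - 1 := by fun_prop
  exact (Real.smoothTransition.contDiff (n := ⊤)).comp this

lemma hasDerivAt_cutoff (s L : ℝ) (n : ℕ) (x : ℝ) :
    HasDerivAt (cutoff s L n) (cutoffDeriv s L n x) x := by
  have h1 : HasDerivAt (fun x : ℝ => (n : ℝ) * (s * (x - L)) - 1) (n * s) x := by
    have := ((((hasDerivAt_id x).sub_const L).const_mul s).const_mul (n : ℝ)).sub_const 1
    exact this.congr_deriv (by ring)
  have h2 : HasDerivAt Real.smoothTransition _ _ :=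
    ((Real.smoothTransition.contDiff (n := 1)).differentiable (by simp)
      (n * (s * (x - L)) - 1)).hasDerivAt
  exact h2.comp x h1

lemma abs_cutoff_le (s L : ℝ) (n : ℕ) (x : ℝ) : |cutoff s L n x| ≤ 1 := by
  rw [cutoff, abs_of_nonneg (Real.smoothTransition.nonneg _)]
  exact Real.smoothTransition.le_one _

lemma tendsto_cutoff {s L x : ℝ} (hx : 0 < s * (x - L)) :
    Tendsto (fun n => cutoff s L n x) atTop (𝓝 1) := by
  have h : Tendsto (fun n : ℕ => (n : ℝ) * (s * (x - L))) atTop atTop :=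
    tendsto_natCast_atTop_atTop.atTop_mul_const hx
  refine tendsto_const_nhds.congr' ?_
  filter_upwards [h.eventually_ge_atTop 2] with n hn
  exact (Real.smoothTransition.one_of_one_le (by linarith)).symm

lemma cutoffDeriv_eq_zero {s L x : ℝ} {n : ℕ} (h : 2 < n * (s * (x - L))) :
    cutoffDeriv s L n x = 0 := by
  rw [cutoffDeriv, deriv_smoothTransition_eq_zero (fun h' => by linarith [h'.2]), zero_mul]

lemma tendsto_integral_cutoff {Ω : Opens ℝ} {s L : ℝ} (hΩ : IsHalfLine Ω s L) (w : X Ω)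
    {ψ : ℝ → ℝ} (hψ : Continuous ψ) (hc : HasCompactSupport ψ) :
    Tendsto (fun n => ∫ x in (Ω : Set ℝ), (ψ x * cutoff s L n x) • w x) atTop
      (𝓝 (∫ x in (Ω : Set ℝ), ψ x • w x)) := by
  refine tendsto_integral_of_dominated_convergence (fun x => ‖ψ x • w x‖) (fun n => ?_)
    (integrable_smul_of_test w hψ hc).norm (fun n => ae_of_all _ fun x => ?_) ?_
  · exact ((hψ.mul (contDiff_cutoff s L n).continuous).aestronglyMeasurable).smul
      (Lp.aestronglyMeasurable w)
  · rw [norm_smul, norm_smul, norm_mul]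
    gcongr
    exact mul_le_of_le_one_right (norm_nonneg _) (abs_cutoff_le s L n x)
  · rw [ae_restrict_iff' Ω.isOpen.measurableSet]
    refine ae_of_all _ fun x hx => ?_
    have := (tendsto_cutoff (hΩ.mem_iff.1 hx)).const_mul (ψ x)
    rw [mul_one] at this
    exact this.smul_const (w x)

/-- Integration by parts on a half-line against a function not vanishing near the endpoint,
when the boundary contribution vanishes. -/
lemma IsWeakDeriv.integral_half_line {Ω : Opens ℝ} {s L : ℝ} (hΩ : IsHalfLine Ω s L)
    {w w₁ : X Ω} (hw : IsWeakDeriv Ω w w₁) {ψ : ℝ → ℝ} (hψ : ContDiff ℝ ∞ ψ)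
    (hc : HasCompactSupport ψ)
    (hb : Tendsto (fun n => ∫ x in (Ω : Set ℝ), (ψ x * cutoffDeriv s L n x) • w x) atTop (𝓝 0)) :
    ∫ x in (Ω : Set ℝ), deriv ψ x • w x = - ∫ x in (Ω : Set ℝ), ψ x • w₁ x := by
  have c' : Continuous (deriv ψ) := hψ.continuous_deriv (by simp)
  have hη : ∀ n, Continuous (cutoff s L n) := fun n => (contDiff_cutoff s L n).continuous
  have t1 := tendsto_integral_cutoff hΩ w c' hc.deriv
  have t2 := tendsto_integral_cutoff hΩ w₁ hψ.continuous hc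
  have t3 := t1.add hb
  rw [add_zero] at t3
  refine tendsto_nhds_unique t3 (t2.neg.congr' ?_)
  filter_upwards [eventually_ge_atTop 1] with n hn
  have hd : ∀ x, HasDerivAt (fun x => ψ x * cutoff s L n x)
      (deriv ψ x * cutoff s L n x + ψ x * cutoffDeriv s L n x) x := fun x =>
    ((hψ.differentiable (by simp) x).hasDerivAt).mul (hasDerivAt_cutoff s L n x)
  have hn0 : (0 : ℝ) < n := by exact_mod_cast hn
  -- The shift by `-1` in `cutoff` makes it vanish for `n s (x - L) ≤ 1`, so the closed support
  -- stays inside `Ω`.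
  have hsupp : tsupport (fun x => ψ x * cutoff s L n x) ⊆ (Ω : Set ℝ) := by
    have hcl : IsClosed {x : ℝ | 1 ≤ n * (s * (x - L))} :=
      isClosed_le continuous_const (by fun_prop)
    refine (closure_minimal (fun x hx => ?_) hcl).trans fun x hx => ?_
    · by_contra h'
      refine hx ?_
      have h2 : ¬ 1 ≤ n * (s * (x - L)) := h'
      simp only [cutoff]
      rw [Real.smoothTransition.zero_of_nonpos (by linarith [not_le.1 h2]), mul_zero]
    · have h2 : 1 ≤ n * (s * (x - L)) := hx
      rw [hΩ.mem_iff]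
      by_contra h'
      nlinarith [not_lt.1 h']
  have key := hw _ (hψ.mul (contDiff_cutoff s L n)) hc.mul_right hsupp
  have e : cutoffDeriv s L n = deriv (cutoff s L n) :=
    funext fun x => (hasDerivAt_cutoff s L n x).deriv.symm
  have cη' : Continuous (cutoffDeriv s L n) := by
    rw [e]
    exact (contDiff_cutoff s L n).continuous_deriv (by simp)
  have i1 : Integrable (fun x => (deriv ψ x * cutoff s L n x) • w x)
      (volume.restrict (Ω : Set ℝ)) :=
    integrable_smul_of_test w (c'.mul (hη n)) hc.deriv.mul_right
  have i2 : Integrable (fun x => (ψ x * cutoffDeriv s L n x) • w x)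
      (volume.restrict (Ω : Set ℝ)) :=
    integrable_smul_of_test w (hψ.continuous.mul cη') hc.mul_right
  rw [← key, ← integral_add i1 i2]
  refine integral_congr_ae (ae_of_all _ fun x => ?_)
  simp only
  rw [(hd x).deriv, add_smul]

lemma IsHalfLine.abs_sub_eq {Ω : Opens ℝ} {s L : ℝ} (hΩ : IsHalfLine Ω s L) {x : ℝ}
    (hx : x ∈ (Ω : Set ℝ)) : |x - L| = s * (x - L) := by
  rw [← abs_of_pos (hΩ.mem_iff.1 hx), abs_mul, hΩ.abs_eq, one_mul]

lemma IsHalfLine.abs_cutoffDeriv_le {Ω : Opens ℝ} {s L C : ℝ} (hΩ : IsHalfLine Ω s L)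
    (hC : ∀ x, |deriv Real.smoothTransition x| ≤ C) (n : ℕ) (x : ℝ) :
    |cutoffDeriv s L n x| ≤ C * n := by
  rw [cutoffDeriv, abs_mul, abs_mul, hΩ.abs_eq, mul_one, Nat.abs_cast]
  exact mul_le_mul_of_nonneg_right (hC _) (Nat.cast_nonneg n)

/-- Inside `Ω` the cutoff derivative has size `O(n)` and is zero beyond distance `2 / n` from `L`,
where `ψ` is `O(1 / n)` because it vanishes at `L`. The product is thus bounded uniformly in `n` and
tends to zero pointwise, so dominated convergence applies. -/
lemma tendsto_boundary_term_of_eq_zero {Ω : Opens ℝ} {s L : ℝ} (hΩ : IsHalfLine Ω s L)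
    (w : X Ω) {ψ : ℝ → ℝ} (hψ : ContDiff ℝ ∞ ψ) (hc : HasCompactSupport ψ) (h0 : ψ L = 0) :
    Tendsto (fun n => ∫ x in (Ω : Set ℝ), (ψ x * cutoffDeriv s L n x) • w x) atTop (𝓝 0) := by
  obtain ⟨C, hC0, hC⟩ := exists_bound_deriv_smoothTransition
  have c' : Continuous (deriv ψ) := hψ.continuous_deriv (by simp)
  obtain ⟨D, hD⟩ := hc.deriv.exists_bound_of_continuous c'
  have hlip : ∀ x, |ψ x| ≤ D * |x - L| := fun x => by
    have := Convex.norm_image_sub_le_of_norm_deriv_le (f := ψ) (s := univ) (x := L) (y := x)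
      (fun y _ => hψ.differentiable (by simp) y) (fun y _ => hD y) convex_univ
      (mem_univ _) (mem_univ _)
    rwa [h0, sub_zero] at this
  have hD0 : 0 ≤ D := (norm_nonneg _).trans (hD 0)
  have hint : Integrable (fun x => 2 * (C * D) * ‖(Icc (L - 2) (L + 2)).indicator w x‖)
      (volume.restrict (Ω : Set ℝ)) := by
    refine (Integrable.norm ?_).const_mul _
    refine IntegrableOn.integrable_indicator ?_ measurableSet_Icc
    exact ((Lp.memLp w).locallyIntegrable (by norm_num)).integrableOn_isCompact isCompact_Icc
  have hlim := tendsto_integral_of_dominated_convergence (μ := volume.restrict (Ω : Set ℝ))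
    (F := fun n x => (ψ x * cutoffDeriv s L n x) • w x) (f := fun _ => 0) _ (fun n => ?_) hint
    (fun n => ?_) ?_
  · simpa using hlim
  · have e : cutoffDeriv s L n = deriv (cutoff s L n) :=
      funext fun x => (hasDerivAt_cutoff s L n x).deriv.symm
    rw [e]
    exact ((hψ.continuous.mul ((contDiff_cutoff s L n).continuous_deriv
      (by simp))).aestronglyMeasurable).smul (Lp.aestronglyMeasurable w)
  · rw [ae_restrict_iff' Ω.isOpen.measurableSet]
    refine ae_of_all _ fun x hx => ?_
    rcases lt_or_ge 2 (n * (s * (x - L))) with h | h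
    · rw [cutoffDeriv_eq_zero h]
      simp only [mul_zero, zero_smul, norm_zero]
      positivity
    -- The localization near `L` needs `n ≥ 1`; for `n = 0` the factor `n` in `cutoffDeriv`
    -- annihilates the term.
    · rcases Nat.eq_zero_or_pos n with rfl | hn
      · simp only [cutoffDeriv, Nat.cast_zero, zero_mul, mul_zero, zero_smul, norm_zero]
        positivity
      have hn1 : (1 : ℝ) ≤ n := by exact_mod_cast hn
      have h1 := hΩ.mem_iff.1 hx
      have h2 : |x - L| ≤ 2 := by
        rw [hΩ.abs_sub_eq hx]
        nlinarith
      have hmem : x ∈ Icc (L - 2) (L + 2) :=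
        ⟨by linarith [(abs_le.1 h2).1], by linarith [(abs_le.1 h2).2]⟩
      rw [indicator_of_mem hmem, norm_smul]
      refine mul_le_mul_of_nonneg_right ?_ (norm_nonneg _)
      rw [Real.norm_eq_abs, abs_mul]
      calc |ψ x| * |cutoffDeriv s L n x| ≤ (D * |x - L|) * (C * n) :=
            mul_le_mul (hlip x) (hΩ.abs_cutoffDeriv_le hC n x) (abs_nonneg _) (by positivity)
        _ = (C * D) * (n * (s * (x - L))) := by rw [hΩ.abs_sub_eq hx]; ring
        _ ≤ (C * D) * 2 := mul_le_mul_of_nonneg_left h (by positivity)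
        _ = 2 * (C * D) := by ring
  · rw [ae_restrict_iff' Ω.isOpen.measurableSet]
    refine ae_of_all _ fun x hx => tendsto_const_nhds.congr' ?_
    have h : Tendsto (fun n : ℕ => (n : ℝ) * (s * (x - L))) atTop atTop :=
      tendsto_natCast_atTop_atTop.atTop_mul_const (hΩ.mem_iff.1 hx)
    filter_upwards [h.eventually_gt_atTop 2] with n hn
    rw [cutoffDeriv_eq_zero hn, mul_zero, zero_smul]

/-- Here the smallness comes from `w` rather than `ψ`: near `L` its continuous representative is at
most `e`. The cutoff derivative is at most `C n`, and the window `S` has length `4 / n`, so the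
integral is at most `4 M C e`. -/
lemma tendsto_boundary_term_of_hasZeroTrace {Ω : Opens ℝ} {s L : ℝ} (hΩ : IsHalfLine Ω s L)
    {w : X Ω} (hw : HasZeroTrace Ω w) {ψ : ℝ → ℝ} (hψ : Continuous ψ)
    (hc : HasCompactSupport ψ) :
    Tendsto (fun n => ∫ x in (Ω : Set ℝ), (ψ x * cutoffDeriv s L n x) • w x) atTop (𝓝 0) := by
  obtain ⟨C, hC0, hC⟩ := exists_bound_deriv_smoothTransition
  obtain ⟨M, hM⟩ := hc.exists_bound_of_continuous hψ
  have hM0 : 0 ≤ M := (norm_nonneg _).trans (hM 0)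
  obtain ⟨u, hu, hwu, hu0⟩ := hw
  have hL : L ∈ frontier (Ω : Set ℝ) := by rw [hΩ.frontier_eq]; rfl
  have hLc : L ∈ closure (Ω : Set ℝ) := frontier_subset_closure hL
  rw [Metric.tendsto_atTop]
  intro ε hε
  set e := ε / (4 * M * C + 1) with he
  have hden : 0 < 4 * M * C + 1 := by positivity
  have he0 : 0 < e := by positivity
  obtain ⟨d, hd, hud⟩ := Metric.continuousOn_iff.1 hu L hLc e he0
  obtain ⟨n₀, hn₀⟩ := exists_nat_gt (2 / d)
  refine ⟨n₀ + 1, fun n hn => ?_⟩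
  have hnn : (n₀ : ℝ) + 1 ≤ n := by exact_mod_cast hn
  have hn0 : (0 : ℝ) < n := by linarith [Nat.cast_nonneg (α := ℝ) n₀]
  rw [dist_zero_right]
  set S : Set ℝ := Icc (L - 2 / n) (L + 2 / n) with hS
  have hbound : ∀ᵐ x ∂(volume.restrict (Ω : Set ℝ)),
      ‖(ψ x * cutoffDeriv s L n x) • w x‖ ≤ S.indicator (fun _ => M * (C * n) * e) x := by
    filter_upwards [hwu, ae_restrict_mem Ω.isOpen.measurableSet] with x hx hxΩ
    rcases lt_or_ge 2 (n * (s * (x - L))) with h | h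
    · rw [cutoffDeriv_eq_zero h, mul_zero, zero_smul, norm_zero]
      exact indicator_nonneg (fun _ _ => by positivity) x
    · have h2 : |x - L| ≤ 2 / n := by
        rw [hΩ.abs_sub_eq hxΩ, le_div_iff₀ hn0]
        linarith
      have hmem : x ∈ S := ⟨by linarith [(abs_le.1 h2).1], by linarith [(abs_le.1 h2).2]⟩
      have h3 : 2 / n < d := by
        rw [div_lt_iff₀ hn0]
        rw [div_lt_iff₀ hd] at hn₀
        nlinarith
      have h4 := hud x (subset_closure hxΩ) (by rw [Real.dist_eq]; linarith)
      rw [hu0 L hL, dist_zero_right] at h4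
      rw [indicator_of_mem hmem, norm_smul, norm_mul, hx]
      have h5 : ‖cutoffDeriv s L n x‖ ≤ C * n := hΩ.abs_cutoffDeriv_le hC n x
      have h6 := hM x
      gcongr
  have hi : Integrable (S.indicator fun _ => M * (C * n) * e) volume :=
    IntegrableOn.integrable_indicator (continuousOn_const.integrableOn_Icc) measurableSet_Icc
  calc ‖∫ x in (Ω : Set ℝ), (ψ x * cutoffDeriv s L n x) • w x‖
      ≤ ∫ x in (Ω : Set ℝ), S.indicator (fun _ => M * (C * n) * e) x :=
        norm_integral_le_of_norm_le hi.restrict hbound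
    _ ≤ ∫ x, S.indicator (fun _ => M * (C * n) * e) x :=
        setIntegral_le_integral hi (ae_of_all _ fun x =>
          indicator_nonneg (fun _ _ => by positivity) x)
    _ = (4 * M * C) * e := by
        rw [integral_indicator measurableSet_Icc, setIntegral_const, smul_eq_mul,
          Real.volume_real_Icc_of_le (by
            have : 0 < 2 / (n : ℝ) := by positivity
            linarith)]
        field_simp
        ring
    _ < (4 * M * C + 1) * e := by nlinarith
    _ = ε := by rw [he]; field_simp

/-- Green's formula for the Neumann second derivative. -/
lemma IsNeumannSecondDeriv.integral_test {Ω : Opens ℝ}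
    (hΩ : (Ω : Set ℝ) = univ ∨ ∃ s L, IsHalfLine Ω s L) {g g₂ : X Ω}
    (hg : IsNeumannSecondDeriv Ω g g₂) {φ : ℝ → ℝ} (hφ : IsNeumannTest Ω φ) :
    ∫ x in (Ω : Set ℝ), φ x • g₂ x = ∫ x in (Ω : Set ℝ), deriv (deriv φ) x • g x := by
  obtain ⟨g₁, h1, h2, h3⟩ := hg
  have hφ' : ContDiff ℝ ∞ (deriv φ) := (contDiff_infty_iff_deriv.1 hφ.contDiff).2
  have hc := hφ.hasCompactSupport
  rcases hΩ with hΩ | ⟨s, L, hΩ⟩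
  · have e1 := h3 φ hφ.contDiff hc (by simp [hΩ])
    have e2 := h1 (deriv φ) hφ' hc.deriv (by simp [hΩ])
    rw [e2, e1, neg_neg]
  -- The two boundary terms vanish for different reasons: the first because `g₁` has zero trace, the
  -- second because `φ' = 0` at the endpoint.
  · have e1 := h3.integral_half_line hΩ hφ.contDiff hc
      (tendsto_boundary_term_of_hasZeroTrace hΩ h2 hφ.contDiff.continuous hc)
    have e2 := h1.integral_half_line hΩ hφ' hc.deriv
      (tendsto_boundary_term_of_eq_zero hΩ g hφ' hc.deriv
        (hφ.deriv_eq_zero L (by rw [hΩ.frontier_eq]; rfl)))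
    rw [e2, e1, neg_neg]

end BoundaryIntegration

/-! ### Resolvents of closures from a lower bound and dense range. -/

section Abstract

variable {E : Type*} [NormedAddCommGroup E] [NormedSpace ℂ E]

lemma isClosable_of_forall_mem_closure_graph {A : E →ₗ.[ℂ] E}
    (h : ∀ x ∈ A.graph.topologicalClosure, x.1 = 0 → x.2 = 0) : A.IsClosable :=
  ⟨A.graph.topologicalClosure.toLinearPMap,
    (Submodule.toLinearPMap_graph_eq A.graph.topologicalClosure h).symm⟩

/-- A closable operator whose shift by `z` is bounded below with dense range on a subspace of its
domain, and whose closure has no eigenvector for `z`, has a closure with a bounded resolvent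
at `z`. -/
lemma exists_isResolvent_closure [CompleteSpace E] {A : E →ₗ.[ℂ] E} (hA : A.IsClosable) {z : ℂ}
    {c : ℝ} (hc : 0 < c) (D : Submodule ℂ A.domain)
    (hbound : ∀ g ∈ D, c * ‖(g : E)‖ ≤ ‖A g - z • (g : E)‖)
    (hdense : (D.map (A.toFun - z • A.domain.subtype)).topologicalClosure = ⊤)
    (hinj : ∀ g : A.closure.domain, A.closure g = z • (g : E) → (g : E) = 0) :
    ∃ R : E →L[ℂ] E, IsResolvent A.closure z R ∧ ‖R‖ ≤ c⁻¹ := by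
  have hsurj : ∀ f : E, ∃ u : A.closure.domain,
      A.closure u - z • (u : E) = f ∧ c * ‖(u : E)‖ ≤ ‖f‖ := by
    intro f
    have hf : f ∈ closure ((D.map (A.toFun - z • A.domain.subtype) : Submodule ℂ E) : Set E) := by
      rw [← Submodule.topologicalClosure_coe, hdense]
      trivial
    obtain ⟨x, hx, hxf⟩ := mem_closure_iff_seq_limit.1 hf
    choose g hgD hgx using fun n => (Submodule.mem_map.1 (hx n))
    have hgx' : ∀ n, A (g n) - z • (g n : E) = x n := hgx
    -- The lower bound on `D` turns convergence of the images into the Cauchy property of the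
    -- preimages; the limit pair then lies in the closure of the graph.
    have hcau : CauchySeq fun n => (g n : E) := by
      have h1 := hxf.cauchySeq
      rw [Metric.cauchySeq_iff] at h1 ⊢
      intro ε hε
      obtain ⟨N, hN⟩ := h1 (c * ε) (by positivity)
      refine ⟨N, fun m hm n hn => ?_⟩
      have h2 := hbound (g m - g n) (D.sub_mem (hgD m) (hgD n))
      have h3 : A (g m - g n) - z • ((g m - g n : A.domain) : E) = x m - x n := by
        rw [LinearPMap.map_sub, Submodule.coe_sub, smul_sub, ← hgx' m, ← hgx' n]
        abel
      rw [h3, ← dist_eq_norm] at h2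
      have h4 := hN m hm n hn
      rw [dist_eq_norm, ← Submodule.coe_sub]
      exact lt_of_mul_lt_mul_left (h2.trans_lt h4) hc.le
    obtain ⟨u, hu⟩ := cauchySeq_tendsto_of_complete hcau
    have hAg : Tendsto (fun n => A (g n)) atTop (𝓝 (f + z • u)) := by
      have := hxf.add (hu.const_smul z)
      refine this.congr fun n => ?_
      rw [← hgx' n]
      abel
    have hmem : (u, f + z • u) ∈ A.closure.graph := by
      rw [← hA.graph_closure_eq_closure_graph]
      refine mem_closure_of_tendsto (hu.prodMk_nhds hAg) (Eventually.of_forall fun n => ?_)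
      exact A.mem_graph (g n)
    obtain ⟨w, hw1, hw2⟩ := (LinearPMap.mem_graph_iff _).1 hmem
    refine ⟨w, ?_, ?_⟩
    · rw [hw2, hw1]
      simp
    · rw [hw1]
      refine le_of_tendsto_of_tendsto' (hu.norm.const_mul c) hxf.norm fun n => ?_
      rw [← hgx' n]
      exact hbound _ (hgD n)
  choose S hS hSb using hsurj
  -- The lower bound is known on `D` only, and `D` is not assumed to be a core, so injectivity on
  -- the whole closure must come from `hinj`. It makes the chosen preimages linear in `f`.
  have huniq : ∀ g h : A.closure.domain, A.closure g - z • (g : E) = A.closure h - z • (h : E) →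
      g = h := by
    intro g h e
    have := hinj (g - h) (by
      rw [LinearPMap.map_sub, Submodule.coe_sub, smul_sub, sub_eq_sub_iff_sub_eq_sub]
      exact e)
    rwa [Submodule.coe_sub, sub_eq_zero, Subtype.coe_inj] at this
  let R₀ : E →ₗ[ℂ] E :=
    { toFun := fun f => (S f : E)
      map_add' := fun f f' => by
        rw [← Submodule.coe_add, Subtype.coe_inj]
        refine huniq _ _ ?_
        rw [hS, LinearPMap.map_add, Submodule.coe_add, smul_add, add_sub_add_comm, hS, hS]
      map_smul' := fun a f => by
        rw [RingHom.id_apply, ← Submodule.coe_smul, Subtype.coe_inj]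
        refine huniq _ _ ?_
        rw [hS, LinearPMap.map_smul, Submodule.coe_smul, smul_comm, ← smul_sub, hS] }
  have hR₀ : ∀ f, ‖R₀ f‖ ≤ c⁻¹ * ‖f‖ := fun f => by
    rw [inv_mul_eq_div, le_div_iff₀ hc, mul_comm]
    exact hSb f
  refine ⟨R₀.mkContinuous c⁻¹ hR₀, ⟨fun f => ⟨(S f).2, hS f⟩, fun g => ?_⟩,
    LinearMap.mkContinuous_norm_le _ (by positivity) _⟩
  change (S (A.closure g - z • (g : E)) : E) = g
  rw [Subtype.coe_inj]
  exact huniq _ _ (hS _)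

lemma le_pseudospectralAbscissa {A : E →ₗ.[ℂ] E} {c : ℝ} (hc : 0 < c)
    (h : ∀ s : ℝ, ∃ R : E →L[ℂ] E, IsResolvent A ((s : ℂ) * Complex.I) R ∧ ‖R‖ ≤ c⁻¹) :
    ENNReal.ofReal c ≤ pseudospectralAbscissa A := by
  rw [pseudospectralAbscissa, ENNReal.le_inv_iff_le_inv, ← ENNReal.ofReal_inv_of_pos hc]
  refine iSup_le fun s => ?_
  obtain ⟨R, hR, hn⟩ := h s
  refine (iInf₂_le R hR).trans ?_
  rw [← ofReal_norm]
  exact ENNReal.ofReal_le_ofReal hn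

end Abstract

/-! ### Neumann test functions as elements of the operator domain. -/

section TestFunctions

variable {Ω : Opens ℝ}

lemma IsNeumannTest.contDiff_deriv {E : Type*} [NormedAddCommGroup E] [NormedSpace ℝ E]
    {G : ℝ → E} (hG : IsNeumannTest Ω G) : ContDiff ℝ ∞ (deriv G) :=
  (contDiff_infty_iff_deriv.1 hG.contDiff).2

lemma IsNeumannTest.contDiff_deriv_deriv {E : Type*} [NormedAddCommGroup E] [NormedSpace ℝ E]
    {G : ℝ → E} (hG : IsNeumannTest Ω G) : ContDiff ℝ ∞ (deriv (deriv G)) :=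
  (contDiff_infty_iff_deriv.1 hG.contDiff_deriv).2

lemma deriv_ofReal_comp {φ : ℝ → ℝ} (hφ : Differentiable ℝ φ) :
    deriv (fun x => (φ x : ℂ)) = fun x => ((deriv φ x : ℝ) : ℂ) :=
  funext fun x => (hφ x).hasDerivAt.ofReal_comp.deriv

lemma IsNeumannTest.ofReal {φ : ℝ → ℝ} (hφ : IsNeumannTest Ω φ) :
    IsNeumannTest Ω fun x => (φ x : ℂ) := by
  refine ⟨Complex.ofRealCLM.contDiff.comp hφ.contDiff,
    hφ.hasCompactSupport.comp_left (g := Complex.ofReal) Complex.ofReal_zero, fun y hy => ?_⟩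
  rw [deriv_ofReal_comp (hφ.contDiff.differentiable (by simp))]
  simp only
  rw [hφ.deriv_eq_zero y hy, Complex.ofReal_zero]

lemma isNeumannTest_of_tsupport_subset {φ : ℝ → ℝ} (hφ : ContDiff ℝ ∞ φ)
    (hc : HasCompactSupport φ) (hs : tsupport φ ⊆ (Ω : Set ℝ)) : IsNeumannTest Ω φ := by
  refine ⟨hφ, hc, fun y hy => ?_⟩
  have hy' : y ∉ tsupport φ := fun h => by
    rw [Ω.isOpen.frontier_eq] at hy
    exact hy.2 (hs h)
  exact image_eq_zero_of_notMem_tsupport fun h => hy' (tsupport_deriv_subset h)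

lemma memLp_of_test {G : ℝ → ℂ} (hG : Continuous G) (hc : HasCompactSupport G) :
    MemLp G 2 (volume.restrict (Ω : Set ℝ)) :=
  (hG.memLp_of_hasCompactSupport hc (p := 2) (μ := volume)).restrict _

lemma isWeakDeriv_of_ae_eq {g g₁ : X Ω} {G : ℝ → ℂ} (hG : ContDiff ℝ ∞ G)
    (hc : HasCompactSupport G) (hg : ∀ᵐ x ∂(volume.restrict (Ω : Set ℝ)), g x = G x)
    (hg₁ : ∀ᵐ x ∂(volume.restrict (Ω : Set ℝ)), g₁ x = deriv G x) : IsWeakDeriv Ω g g₁ := by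
  intro φ hφ hφc hs
  have hcompl : ∀ x ∉ (Ω : Set ℝ), x ∉ tsupport φ := fun x hx h => hx (hs h)
  have c' : Continuous (deriv G) := hG.continuous_deriv (by simp)
  have cφ' : Continuous (deriv φ) := hφ.continuous_deriv (by simp)
  have ext : ∀ h : ℝ → ℂ, (∀ x ∉ (Ω : Set ℝ), h x = 0) → ∫ x in (Ω : Set ℝ), h x = ∫ x, h x :=
    fun h hh => setIntegral_eq_integral_of_forall_compl_eq_zero hh
  have e1 : ∫ x in (Ω : Set ℝ), deriv φ x • g x = ∫ x, ((deriv φ x : ℝ) : ℂ) * G x := by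
    rw [← ext _ fun x hx => by
      rw [image_eq_zero_of_notMem_tsupport fun h => hcompl x hx (tsupport_deriv_subset h),
        Complex.ofReal_zero, zero_mul]]
    refine integral_congr_ae ?_
    filter_upwards [hg] with x hx
    rw [hx, Complex.real_smul]
  have e2 : ∫ x in (Ω : Set ℝ), φ x • g₁ x = ∫ x, (φ x : ℂ) * deriv G x := by
    rw [← ext _ fun x hx => by
      rw [image_eq_zero_of_notMem_tsupport (hcompl x hx), Complex.ofReal_zero, zero_mul]]
    refine integral_congr_ae ?_
    filter_upwards [hg₁] with x hx
    rw [hx, Complex.real_smul]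
  have k1 : Continuous fun x => (φ x : ℂ) := Complex.continuous_ofReal.comp hφ.continuous
  have k2 : Continuous fun x => ((deriv φ x : ℝ) : ℂ) := Complex.continuous_ofReal.comp cφ'
  have := integral_mul_deriv_eq_deriv_mul_of_integrable (u := fun x => (φ x : ℂ)) (v := G)
    (u' := fun x => ((deriv φ x : ℝ) : ℂ)) (v' := deriv G)
    (fun x _ => ((hφ.differentiable (by simp) x).hasDerivAt).ofReal_comp)
    (fun x _ => (hG.differentiable (by simp) x).hasDerivAt)
    ((k1.mul c').integrable_of_hasCompactSupport hc.deriv.mul_left)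
    ((k2.mul hG.continuous).integrable_of_hasCompactSupport hc.mul_left)
    ((k1.mul hG.continuous).integrable_of_hasCompactSupport hc.mul_left)
  rw [e1, e2, this, neg_neg]

lemma isNeumannSecondDeriv_of_ae_eq {g g₂ : X Ω} {G : ℝ → ℂ} (hG : IsNeumannTest Ω G)
    (hg : ∀ᵐ x ∂(volume.restrict (Ω : Set ℝ)), g x = G x)
    (hg₂ : ∀ᵐ x ∂(volume.restrict (Ω : Set ℝ)), g₂ x = deriv (deriv G) x) :
    IsNeumannSecondDeriv Ω g g₂ := by
  have hm : MemLp (deriv G) 2 (volume.restrict (Ω : Set ℝ)) :=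
    memLp_of_test hG.contDiff_deriv.continuous hG.hasCompactSupport.deriv
  refine ⟨hm.toLp _, isWeakDeriv_of_ae_eq hG.contDiff hG.hasCompactSupport hg hm.coeFn_toLp,
    ⟨deriv G, hG.contDiff_deriv.continuous.continuousOn, hm.coeFn_toLp, hG.deriv_eq_zero⟩,
    isWeakDeriv_of_ae_eq hG.contDiff_deriv hG.hasCompactSupport.deriv hm.coeFn_toLp hg₂⟩

lemma memLp_mul_test {v : ℝ → ℝ} (hv : ContinuousOn v (closure (Ω : Set ℝ))) {G : ℝ → ℂ}
    (hG : Continuous G) (hc : HasCompactSupport G) :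
    MemLp (fun x => (v x : ℂ) * G x) 2 (volume.restrict (Ω : Set ℝ)) := by
  obtain ⟨M, hM⟩ := (hc.isCompact.inter_left isClosed_closure).exists_bound_of_continuousOn
    (hv.mono inter_subset_left)
  refine (memLp_of_test (Ω := Ω) hG hc).of_le_mul (c := M) ?_ ?_
  · refine ContinuousOn.aestronglyMeasurable ?_ Ω.isOpen.measurableSet
    exact (Complex.continuous_ofReal.comp_continuousOn (hv.mono subset_closure)).mul
      hG.continuousOn
  · rw [ae_restrict_iff' Ω.isOpen.measurableSet]
    refine ae_of_all _ fun x hx => ?_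
    by_cases hx' : x ∈ tsupport G
    · rw [norm_mul, Complex.norm_real]
      exact mul_le_mul_of_nonneg_right (hM x ⟨subset_closure hx, hx'⟩) (norm_nonneg _)
    · rw [image_eq_zero_of_notMem_tsupport hx']
      simp

/-- The elements of `neumannDomain` represented by Neumann test functions. -/
def neumannTests (Ω : Opens ℝ) (v : ℝ → ℝ) : Submodule ℂ (neumannDomain Ω v) where
  carrier := {g | ∃ G : ℝ → ℂ, IsNeumannTest Ω G ∧
    ∀ᵐ x ∂(volume.restrict (Ω : Set ℝ)), (g : X Ω) x = G x}
  add_mem' := by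
    rintro g h ⟨G, hG, hg⟩ ⟨F, hF, hh⟩
    refine ⟨fun x => G x + F x, ⟨hG.contDiff.add hF.contDiff,
      hG.hasCompactSupport.add hF.hasCompactSupport, fun y hy => ?_⟩, ?_⟩
    · have := ((hG.contDiff.differentiable (by simp) y).hasDerivAt.add
        (hF.contDiff.differentiable (by simp) y).hasDerivAt).deriv
      rw [hG.deriv_eq_zero y hy, hF.deriv_eq_zero y hy, add_zero] at this
      exact this
    · filter_upwards [Lp.coeFn_add (g : X Ω) (h : X Ω), hg, hh] with x h1 h2 h3
      rw [Submodule.coe_add, h1, Pi.add_apply, h2, h3]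
  zero_mem' := by
    refine ⟨fun _ => 0, ⟨contDiff_const, HasCompactSupport.zero, fun y _ => by simp⟩, ?_⟩
    filter_upwards [Lp.coeFn_zero ℂ 2 (volume.restrict (Ω : Set ℝ))] with x h1
    rw [Submodule.coe_zero, h1, Pi.zero_apply]
  smul_mem' := by
    rintro c g ⟨G, hG, hg⟩
    refine ⟨fun x => c * G x, ⟨contDiff_const.mul hG.contDiff, hG.hasCompactSupport.mul_left,
      fun y hy => ?_⟩, ?_⟩
    · have := ((hG.contDiff.differentiable (by simp) y).hasDerivAt.const_mul c).deriv
      rwa [hG.deriv_eq_zero y hy, mul_zero] at this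
    · filter_upwards [Lp.coeFn_smul c (g : X Ω), hg] with x h1 h2
      rw [Submodule.coe_smul, h1, Pi.smul_apply, h2, smul_eq_mul]

lemma exists_mem_neumannTests {v : ℝ → ℝ} (hv : ContinuousOn v (closure (Ω : Set ℝ)))
    {G : ℝ → ℂ} (hG : IsNeumannTest Ω G) : ∃ g ∈ neumannTests Ω v,
      ∀ᵐ x ∂(volume.restrict (Ω : Set ℝ)), (g : X Ω) x = G x := by
  have hm : MemLp G 2 (volume.restrict (Ω : Set ℝ)) :=
    memLp_of_test hG.contDiff.continuous hG.hasCompactSupport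
  have hm₂ : MemLp (deriv (deriv G)) 2 (volume.restrict (Ω : Set ℝ)) :=
    memLp_of_test hG.contDiff_deriv_deriv.continuous hG.hasCompactSupport.deriv.deriv
  have hmem : hm.toLp G ∈ neumannDomain Ω v := by
    refine ⟨⟨_, isNeumannSecondDeriv_of_ae_eq hG hm.coeFn_toLp hm₂.coeFn_toLp⟩,
      (memLp_congr_ae ?_).2 (memLp_mul_test hv hG.contDiff.continuous hG.hasCompactSupport)⟩
    filter_upwards [hm.coeFn_toLp] with x hx
    rw [hx]
  exact ⟨⟨_, hmem⟩, ⟨G, hG, hm.coeFn_toLp⟩, hm.coeFn_toLp⟩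

/-- The shifted operator acts classically on test functions. -/
lemma operatorCore_sub_smul_ae_eq {v : ℝ → ℝ} {g : neumannDomain Ω v} {G : ℝ → ℂ}
    (hG : IsNeumannTest Ω G) (hg : ∀ᵐ x ∂(volume.restrict (Ω : Set ℝ)), (g : X Ω) x = G x)
    (ν k s : ℝ) : ∀ᵐ x ∂(volume.restrict (Ω : Set ℝ)),
      (operatorCore Ω v ν k g - ((s : ℂ) * Complex.I) • (g : X Ω) : X Ω) x =
        -(ν : ℂ) * deriv (deriv G) x + Complex.I * (k * v x - s : ℝ) * G x := by
  have hm₂ : MemLp (deriv (deriv G)) 2 (volume.restrict (Ω : Set ℝ)) :=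
    memLp_of_test hG.contDiff_deriv_deriv.continuous hG.hasCompactSupport.deriv.deriv
  have h2 : secondDeriv g = hm₂.toLp _ :=
    (secondDeriv_spec g).unique (isNeumannSecondDeriv_of_ae_eq hG hg hm₂.coeFn_toLp)
  have h3 : operatorCore Ω v ν k g =
      -((ν : ℂ) • secondDeriv g) + (Complex.I * (k : ℂ)) • mulV g := rfl
  rw [h3, h2]
  filter_upwards [Lp.coeFn_sub (-((ν : ℂ) • hm₂.toLp _) + (Complex.I * (k : ℂ)) • mulV g)
      (((s : ℂ) * Complex.I) • (g : X Ω)), Lp.coeFn_add (-((ν : ℂ) • hm₂.toLp _))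
      ((Complex.I * (k : ℂ)) • mulV g), Lp.coeFn_neg ((ν : ℂ) • hm₂.toLp _),
    Lp.coeFn_smul (ν : ℂ) (hm₂.toLp _), Lp.coeFn_smul (Complex.I * (k : ℂ)) (mulV g),
    Lp.coeFn_smul ((s : ℂ) * Complex.I) (g : X Ω), mulV_spec g, hm₂.coeFn_toLp, hg]
    with x a1 a2 a3 a4 a5 a6 a7 a8 a9
  rw [a1, Pi.sub_apply, a2, Pi.add_apply, a3, Pi.neg_apply, a4, Pi.smul_apply, a5, Pi.smul_apply,
    a6, Pi.smul_apply, a7, a8, a9]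
  simp only [smul_eq_mul]
  push_cast
  ring

end TestFunctions

/-! ### Formal adjoint: dense range, closability and absence of imaginary eigenvalues. -/

section Adjoint

open ComplexConjugate

variable {Ω : Opens ℝ} {v : ℝ → ℝ}

lemma inner_of_ae_eq_ofReal {p f : X Ω} {φ : ℝ → ℝ}
    (hp : ∀ᵐ x ∂(volume.restrict (Ω : Set ℝ)), p x = (φ x : ℂ)) :
    inner ℂ p f = ∫ x in (Ω : Set ℝ), φ x • f x := by
  rw [L2.inner_def]
  refine integral_congr_ae ?_
  filter_upwards [hp] with x hx
  rw [hx, RCLike.inner_apply, Complex.conj_ofReal, Complex.real_smul, mul_comm]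

/-- Pairing of the shifted operator on real test functions with an arbitrary function. -/
lemma inner_operatorCore_sub_smul {p : neumannDomain Ω v} {φ : ℝ → ℝ} (hφ : IsNeumannTest Ω φ)
    (hp : ∀ᵐ x ∂(volume.restrict (Ω : Set ℝ)), (p : X Ω) x = (φ x : ℂ)) (ν k s : ℝ) (f : X Ω) :
    inner ℂ (operatorCore Ω v ν k p - ((s : ℂ) * Complex.I) • (p : X Ω)) f =
      -(ν : ℂ) * (∫ x in (Ω : Set ℝ), deriv (deriv φ) x • f x) -
        ∫ x in (Ω : Set ℝ), φ x • (Complex.I * (k * v x - s : ℝ) * f x) := by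
  have hd : deriv (deriv fun x => (φ x : ℂ)) = fun x => ((deriv (deriv φ) x : ℝ) : ℂ) := by
    rw [deriv_ofReal_comp (hφ.contDiff.differentiable (by simp)),
      deriv_ofReal_comp (hφ.contDiff_deriv.differentiable (by simp))]
  have hae := operatorCore_sub_smul_ae_eq hφ.ofReal hp ν k s
  rw [hd] at hae
  set q : X Ω := operatorCore Ω v ν k p - ((s : ℂ) * Complex.I) • (p : X Ω) with hq
  have i1 : Integrable (fun x => -(ν : ℂ) * (deriv (deriv φ) x • f x))
      (volume.restrict (Ω : Set ℝ)) :=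
    (integrable_smul_of_test f hφ.contDiff_deriv_deriv.continuous
      hφ.hasCompactSupport.deriv.deriv).const_mul _
  have hpt : ∀ᵐ x ∂(volume.restrict (Ω : Set ℝ)), inner ℂ (q x) (f x) =
      -(ν : ℂ) * (deriv (deriv φ) x • f x) - φ x • (Complex.I * (k * v x - s : ℝ) * f x) := by
    filter_upwards [hae] with x hx
    rw [hx, RCLike.inner_apply]
    simp only [Complex.real_smul, map_add, map_mul, map_neg, Complex.conj_ofReal, Complex.conj_I]
    ring
  have i2 : Integrable (fun x => φ x • (Complex.I * (k * v x - s : ℝ) * f x))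
      (volume.restrict (Ω : Set ℝ)) := by
    refine (i1.sub (L2.integrable_inner (𝕜 := ℂ) q f)).congr ?_
    filter_upwards [hpt] with x hx
    rw [Pi.sub_apply, hx]
    ring
  rw [L2.inner_def, integral_congr_ae hpt, integral_sub i1 i2, integral_const_mul]

/-- Absence of nonzero `L²` functions orthogonal to the range of the shifted operator on test
functions. -/
lemma eq_zero_of_inner_operatorCore_eq_zero
    (hΩ : (Ω : Set ℝ) = univ ∨ ∃ s L, IsHalfLine Ω s L)
    (hv : ContinuousOn v (closure (Ω : Set ℝ))) {ν k s : ℝ} (hν : 0 < ν) {f : X Ω}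
    (hf : ∀ p ∈ neumannTests Ω v,
      inner ℂ (operatorCore Ω v ν k p - ((s : ℂ) * Complex.I) • (p : X Ω)) f = 0) : f = 0 := by
  -- The inner product conjugates its first argument, so `f` solves the adjoint equation; hence the
  -- minus sign in `Q`.
  refine eq_zero_of_weak_neumann_solution hΩ f (Q := fun x => -(k * v x - s) / ν)
    (((continuousOn_const.mul hv).sub continuousOn_const).neg.div_const ν) fun φ hφ => ?_
  obtain ⟨p, hp, hpφ⟩ := exists_mem_neumannTests hv hφ.ofReal
  have h0 := hf p hp
  rw [inner_operatorCore_sub_smul hφ hpφ] at h0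
  have e : ∫ x in (Ω : Set ℝ), φ x • (Complex.I * ((-(k * v x - s) / ν : ℝ) : ℂ) * f x) =
      -(1 / (ν : ℂ)) * ∫ x in (Ω : Set ℝ), φ x • (Complex.I * (k * v x - s : ℝ) * f x) := by
    rw [← integral_const_mul]
    refine integral_congr_ae (ae_of_all _ fun x => ?_)
    simp only [Complex.real_smul]
    push_cast
    ring
  have hν' : (ν : ℂ) ≠ 0 := by exact_mod_cast hν.ne'
  rw [e, ← sub_eq_zero.1 h0]
  field_simp

lemma topologicalClosure_map_neumannTests
    (hΩ : (Ω : Set ℝ) = univ ∨ ∃ s L, IsHalfLine Ω s L)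
    (hv : ContinuousOn v (closure (Ω : Set ℝ))) {ν : ℝ} (k s : ℝ) (hν : 0 < ν) :
    ((neumannTests Ω v).map ((operatorCore Ω v ν k).toFun -
      ((s : ℂ) * Complex.I) • (operatorCore Ω v ν k).domain.subtype)).topologicalClosure = ⊤ := by
  rw [Submodule.topologicalClosure_eq_top_iff, Submodule.eq_bot_iff]
  intro f hf
  refine eq_zero_of_inner_operatorCore_eq_zero hΩ hv (ν := ν) (k := k) (s := s) hν
    fun p hp => ?_
  exact (Submodule.mem_orthogonal _ f).1 hf _ (Submodule.mem_map_of_mem hp)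

/-- The formal adjoint of `operatorCore` is obtained by changing the sign of `k`. -/
lemma inner_operatorCore_right (hΩ : (Ω : Set ℝ) = univ ∨ ∃ s L, IsHalfLine Ω s L)
    {p : neumannDomain Ω v} {φ : ℝ → ℝ} (hφ : IsNeumannTest Ω φ)
    (hp : ∀ᵐ x ∂(volume.restrict (Ω : Set ℝ)), (p : X Ω) x = (φ x : ℂ)) (ν k : ℝ)
    (g : neumannDomain Ω v) :
    inner ℂ (p : X Ω) (operatorCore Ω v ν k g) =
      inner ℂ (operatorCore Ω v ν (-k) p) (g : X Ω) := by
  have h3 : ∀ (κ : ℝ) (u : neumannDomain Ω v), operatorCore Ω v ν κ u =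
      -((ν : ℂ) • secondDeriv u) + (Complex.I * (κ : ℂ)) • mulV u := fun _ _ => rfl
  have hd : deriv (deriv fun x => (φ x : ℂ)) = fun x => ((deriv (deriv φ) x : ℝ) : ℂ) := by
    rw [deriv_ofReal_comp (hφ.contDiff.differentiable (by simp)),
      deriv_ofReal_comp (hφ.contDiff_deriv.differentiable (by simp))]
  have hm₂ : MemLp (deriv (deriv fun x => (φ x : ℂ))) 2 (volume.restrict (Ω : Set ℝ)) :=
    memLp_of_test hφ.ofReal.contDiff_deriv_deriv.continuous
      hφ.ofReal.hasCompactSupport.deriv.deriv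
  have h2 : secondDeriv p = hm₂.toLp _ :=
    (secondDeriv_spec p).unique (isNeumannSecondDeriv_of_ae_eq hφ.ofReal hp hm₂.coeFn_toLp)
  have hp₂ : ∀ᵐ x ∂(volume.restrict (Ω : Set ℝ)),
      secondDeriv p x = ((deriv (deriv φ) x : ℝ) : ℂ) := by
    rw [h2]
    filter_upwards [hm₂.coeFn_toLp] with x hx
    rw [hx, hd]
  have e1 : inner ℂ (p : X Ω) (secondDeriv g) = inner ℂ (secondDeriv p) (g : X Ω) := by
    rw [inner_of_ae_eq_ofReal hp, inner_of_ae_eq_ofReal hp₂]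
    exact (secondDeriv_spec g).integral_test hΩ hφ
  have e2 : inner ℂ (p : X Ω) (mulV g) = inner ℂ (mulV p) (g : X Ω) := by
    rw [L2.inner_def, L2.inner_def]
    refine integral_congr_ae ?_
    filter_upwards [mulV_spec g, mulV_spec p] with x h1 h2
    rw [h1, h2, RCLike.inner_apply, RCLike.inner_apply, map_mul, Complex.conj_ofReal]
    ring
  rw [h3, h3, inner_add_right, inner_add_left, inner_neg_right, inner_neg_left, inner_smul_right,
    inner_smul_left, inner_smul_right, inner_smul_left, e1, e2]
  simp

/-- The adjoint identity is a closed condition on the pair `y`, so it passes from the graph to its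
closure. It replaces an explicit description of the domain of the closure. -/
lemma inner_of_mem_closure_graph (hΩ : (Ω : Set ℝ) = univ ∨ ∃ s L, IsHalfLine Ω s L)
    {p : neumannDomain Ω v} {φ : ℝ → ℝ} (hφ : IsNeumannTest Ω φ)
    (hp : ∀ᵐ x ∂(volume.restrict (Ω : Set ℝ)), (p : X Ω) x = (φ x : ℂ)) (ν k : ℝ)
    {y : X Ω × X Ω} (hy : y ∈ (operatorCore Ω v ν k).graph.topologicalClosure) :
    inner ℂ (p : X Ω) y.2 = inner ℂ (operatorCore Ω v ν (-k) p) y.1 := by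
  have hcl : IsClosed {y : X Ω × X Ω |
      inner ℂ (p : X Ω) y.2 = inner ℂ (operatorCore Ω v ν (-k) p) y.1} :=
    isClosed_eq (by fun_prop) (by fun_prop)
  refine closure_minimal (fun y hy => ?_) hcl hy
  obtain ⟨g, hg1, hg2⟩ := (LinearPMap.mem_graph_iff _).1 hy
  change inner ℂ (p : X Ω) y.2 = inner ℂ (operatorCore Ω v ν (-k) p) y.1
  rw [← hg1, ← hg2]
  exact inner_operatorCore_right hΩ hφ hp ν k g

/-- If the first component of a limit pair is zero, the adjoint identity makes the second orthogonal
to every test function supported in `Ω`, hence zero. -/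
lemma isClosable_operatorCore (hΩ : (Ω : Set ℝ) = univ ∨ ∃ s L, IsHalfLine Ω s L)
    (hv : ContinuousOn v (closure (Ω : Set ℝ))) (ν k : ℝ) :
    (operatorCore Ω v ν k).IsClosable := by
  refine isClosable_of_forall_mem_closure_graph fun y hy hy1 => ?_
  have hlint : LocallyIntegrableOn (y.2 : X Ω) (Ω : Set ℝ) volume :=
    locallyIntegrableOn_of_locallyIntegrable_restrict
      ((Lp.memLp y.2).locallyIntegrable (by norm_num))
  have h0 := Ω.isOpen.ae_eq_zero_of_integral_contDiff_smul_eq_zero hlint (by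
    intro φ h1 h2 h3
    have hφ := isNeumannTest_of_tsupport_subset h1 h2 h3
    obtain ⟨p, -, hp⟩ := exists_mem_neumannTests hv hφ.ofReal
    have := inner_of_mem_closure_graph hΩ hφ hp ν k hy
    rw [hy1, inner_zero_right, inner_of_ae_eq_ofReal hp] at this
    rw [← this]
    exact (setIntegral_eq_integral_of_forall_compl_eq_zero fun x hx => by
      rw [image_eq_zero_of_notMem_tsupport (fun h => hx (h3 h)), zero_smul]).symm)
  refine Lp.ext ?_
  filter_upwards [(ae_restrict_iff' Ω.isOpen.measurableSet).2 h0,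
    Lp.coeFn_zero ℂ 2 (volume.restrict (Ω : Set ℝ))] with x h1 h2
  rw [h1, h2, Pi.zero_apply]

/-- Tested against the formal adjoint, with `-k` and `-s` in place of `k` and `s`, an eigenvector
becomes a weak Neumann solution of `g'' = i Q g`, to which the convexity argument applies. -/
lemma eq_zero_of_closure_eigenvector (hΩ : (Ω : Set ℝ) = univ ∨ ∃ s L, IsHalfLine Ω s L)
    (hv : ContinuousOn v (closure (Ω : Set ℝ))) {ν k s : ℝ} (hν : 0 < ν)
    (g : (operatorCore Ω v ν k).closure.domain)
    (hg : (operatorCore Ω v ν k).closure g = ((s : ℂ) * Complex.I) • (g : X Ω)) :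
    (g : X Ω) = 0 := by
  have hmem : ((g : X Ω), ((s : ℂ) * Complex.I) • (g : X Ω)) ∈
      (operatorCore Ω v ν k).graph.topologicalClosure := by
    rw [(isClosable_operatorCore hΩ hv ν k).graph_closure_eq_closure_graph, ← hg]
    exact LinearPMap.mem_graph _ g
  refine eq_zero_of_weak_neumann_solution hΩ _ (Q := fun x => (k * v x - s) / ν)
    (((continuousOn_const.mul hv).sub continuousOn_const).div_const ν) fun φ hφ => ?_
  obtain ⟨p, hp, hpφ⟩ := exists_mem_neumannTests hv hφ.ofReal
  have h0 : inner ℂ (operatorCore Ω v ν (-k) p - (((-s : ℝ) : ℂ) * Complex.I) • (p : X Ω))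
      (g : X Ω) = 0 := by
    have := inner_of_mem_closure_graph hΩ hφ hpφ ν k hmem
    simp only at this
    rw [inner_sub_left, ← this, inner_smul_left, inner_smul_right]
    simp
  rw [inner_operatorCore_sub_smul hφ hpφ] at h0
  have e : ∫ x in (Ω : Set ℝ), φ x • (Complex.I * (((k * v x - s) / ν : ℝ) : ℂ) * (g : X Ω) x) =
      -(1 / (ν : ℂ)) *
        ∫ x in (Ω : Set ℝ), φ x • (Complex.I * (-k * v x - -s : ℝ) * (g : X Ω) x) := by
    rw [← integral_const_mul]
    refine integral_congr_ae (ae_of_all _ fun x => ?_)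
    simp only [Complex.real_smul]
    push_cast
    ring
  have hν' : (ν : ℂ) ≠ 0 := by exact_mod_cast hν.ne'
  rw [e, ← sub_eq_zero.1 h0]
  field_simp

end Adjoint

/-! ### Choice of scale and the uniform estimate on test functions. -/

section Resolvent

variable {Ω : Opens ℝ} {v : ℝ → ℝ}

lemma norm_eq_sqrt_integral {g : X Ω} {G : ℝ → ℂ}
    (hg : ∀ᵐ x ∂(volume.restrict (Ω : Set ℝ)), g x = G x) :
    ‖g‖ = √(∫ x in (Ω : Set ℝ), ‖G x‖ ^ 2) := by
  have h1 : ((‖g‖ ^ 2 : ℝ) : ℂ) = ((∫ x in (Ω : Set ℝ), ‖G x‖ ^ 2 : ℝ) : ℂ) := by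
    have h2 := inner_self_eq_norm_sq_to_K (𝕜 := ℂ) g
    rw [L2.inner_def] at h2
    rw [← integral_complex_ofReal, Complex.ofReal_pow]
    refine h2.symm.trans (integral_congr_ae ?_)
    filter_upwards [hg] with x hx
    rw [hx, inner_self_eq_norm_sq_to_K]
    simp
  rw [← Complex.ofReal_injective h1, Real.sqrt_sq (norm_nonneg g)]

/-- Bounded intervals, a multiple of `δ` long, that fill `Ω` up to distance `R`. -/
lemma exists_filling_interval (hΩ : (Ω : Set ℝ) = univ ∨ ∃ s L, IsHalfLine Ω s L) {R δ : ℝ}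
    (hδ : 0 < δ) : ∃ (a : ℝ) (N : ℕ), Icc a (a + N * δ) ⊆ closure (Ω : Set ℝ) ∧
      Ioo a (a + N * δ) ⊆ (Ω : Set ℝ) ∧ (a ∈ frontier (Ω : Set ℝ) ∨ a ≤ -R) ∧
      (a + N * δ ∈ frontier (Ω : Set ℝ) ∨ R ≤ a + N * δ) ∧
      ∀ x ∈ (Ω : Set ℝ), x ∈ Ioo (-R) R → x ∈ Ioo a (a + N * δ) := by
  have hN : ∀ r : ℝ, ∃ N : ℕ, r ≤ N * δ := fun r => by
    obtain ⟨N, hN⟩ := exists_nat_ge (r / δ)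
    exact ⟨N, (div_le_iff₀ hδ).1 hN⟩
  rcases hΩ with h | ⟨s, L, h⟩
  · obtain ⟨N, hN⟩ := hN (2 * R)
    refine ⟨-R, N, by simp [h], by simp [h], Or.inr le_rfl, Or.inr (by linarith),
      fun x _ hx => ⟨hx.1, by linarith [hx.2]⟩⟩
  · have hfr := h.frontier_eq
    rcases h.eq_Ioi_or_Iio with ⟨-, e⟩ | ⟨-, e⟩
    · obtain ⟨N, hN⟩ := hN (R - L)
      refine ⟨L, N, ?_, ?_, Or.inl (by simp [hfr]), Or.inr (by linarith), fun x hx hxR => ?_⟩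
      · rw [e, closure_Ioi]
        exact Icc_subset_Ici_self
      · rw [e]
        exact Ioo_subset_Ioi_self
      · rw [e] at hx
        exact ⟨hx, by linarith [hxR.2]⟩
    · obtain ⟨N, hN⟩ := hN (L + R)
      have e' : L - N * δ + N * δ = L := by ring
      refine ⟨L - N * δ, N, ?_, ?_, Or.inr (by linarith), Or.inl (by simp [hfr]), fun x hx hxR => ?_⟩
      · rw [e, closure_Iio, e']
        exact Icc_subset_Iic_self
      · rw [e, e']
        exact Ioo_subset_Iio_self
      · rw [e] at hx
        rw [e']
        exact ⟨by linarith [hxR.1], hx⟩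

lemma rate_pos (m : ℕ) {ν k : ℝ} (hν : 0 < ν) (hk : k ≠ 0) : 0 < rate m ν k := by
  have : 0 < |k| := abs_pos.2 hk
  rw [rate]
  split_ifs
  · positivity
  · positivity

/-- The length scale at which diffusion and mixing balance. -/
lemma exists_scale (m : ℕ) {ν k : ℝ} (hν : 0 < ν) (hk : k ≠ 0) :
    ∃ δ : ℝ, 0 < δ ∧ δ ≤ 1 ∧ rate m ν k ≤ |k| * δ ^ m ∧ δ ^ 2 * rate m ν k ≤ ν ∧
      ν * rate m ν k ≤ (|k| * δ ^ (m + 1)) ^ 2 := by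
  have hk0 : 0 < |k| := abs_pos.2 hk
  rcases le_or_gt ν |k| with h | h
  · have hm : (0 : ℝ) < m + 2 := by positivity
    -- The scale with `ν = |k| δ ^ (m + 2)`, for which all three relations are equalities.
    set δ : ℝ := (ν / |k|) ^ ((1 : ℝ) / (m + 2)) with hδ
    have hq : 0 < ν / |k| := by positivity
    have hδ0 : 0 < δ := Real.rpow_pos_of_pos hq _
    have hδ1 : δ ≤ 1 := Real.rpow_le_one hq.le ((div_le_one hk0).2 h) (by positivity)
    have hpow : δ ^ (m + 2) = ν / |k| := by
      rw [hδ, ← Real.rpow_natCast, ← Real.rpow_mul hq.le]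
      push_cast
      rw [one_div, inv_mul_cancel₀ hm.ne', Real.rpow_one]
    have hν' : ν = |k| * δ ^ (m + 2) := by rw [hpow]; field_simp
    have hrate : rate m ν k = |k| * δ ^ m := by
      have h1 : ν ^ ((m : ℝ) / (m + 2)) = |k| ^ ((m : ℝ) / (m + 2)) * δ ^ m := by
        conv_lhs => rw [hν']
        rw [Real.mul_rpow hk0.le (by positivity), ← Real.rpow_natCast δ (m + 2),
          ← Real.rpow_mul hδ0.le, ← Real.rpow_natCast δ m]
        congr 2
        push_cast
        field_simp
      rw [rate, if_pos h, h1, mul_right_comm, ← Real.rpow_add hk0, ← add_div,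
        div_self hm.ne', Real.rpow_one]
    refine ⟨δ, hδ0, hδ1, hrate.le, ?_, ?_⟩
    · rw [hrate]
      refine le_of_eq ?_
      conv_rhs => rw [hν']
      ring
    · rw [hrate]
      refine le_of_eq ?_
      conv_lhs => rw [hν']
      ring
  · have hrate : rate m ν k = k ^ 2 / ν := by rw [rate, if_neg (not_le.2 h)]
    have hk2 : k ^ 2 = |k| ^ 2 := (sq_abs k).symm
    -- When diffusion dominates, the scale is capped at 1. Only the third relation, coming from the
    -- mixed term, is then an equality, and it dictates the rate `k ^ 2 / ν`.
    refine ⟨1, one_pos, le_rfl, ?_, ?_, ?_⟩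
    · rw [hrate, hk2, div_le_iff₀ hν, one_pow, mul_one]
      nlinarith
    · rw [hrate, hk2, one_pow, one_mul, div_le_iff₀ hν]
      nlinarith
    · rw [hrate, hk2, one_pow, mul_one, mul_div_cancel₀ _ hν.ne']

/-- The resolvent estimate on test functions. -/
lemma rate_mul_norm_le (hΩ : (Ω : Set ℝ) = univ ∨ ∃ s L, IsHalfLine Ω s L)
    (hv : ContinuousOn v (closure (Ω : Set ℝ))) {m : ℕ} {l c : ℝ} (hl : 0 < l) (hc : 0 < c)
    (hgeom : ∀ a δ σ : ℝ, 0 < δ → δ ≤ 1 → Icc a (a + δ) ⊆ closure (Ω : Set ℝ) →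
      ∃ p, a ≤ p ∧ p + l * δ ≤ a + δ ∧ ((∀ x ∈ Icc p (p + l * δ), c * δ ^ m ≤ v x - σ) ∨
        ∀ x ∈ Icc p (p + l * δ), c * δ ^ m ≤ -(v x - σ)))
    {ν k : ℝ} (s : ℝ) (hν : 0 < ν) (hk : k ≠ 0) {K : ℝ} (hK : K = 3 / (l * c) + 12 / (l ^ 2 * c))
    {g : neumannDomain Ω v} (hg : g ∈ neumannTests Ω v) :
    rate m ν k * ‖(g : X Ω)‖ ≤ (2 * K + K ^ 2 + 4) *
      ‖operatorCore Ω v ν k g - ((s : ℂ) * Complex.I) • (g : X Ω)‖ := by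
  obtain ⟨G, hG, hgG⟩ := hg
  have hk0 : 0 < |k| := abs_pos.2 hk
  obtain ⟨δ, hδ0, hδ1, hr1, hr2, hr3⟩ := exists_scale m hν hk
  have hr := rate_pos m hν hk
  set r := rate m ν k with hrdef
  obtain ⟨R₀, hR₀, hs₀⟩ := exists_support_subset_Ioo hG.hasCompactSupport
  obtain ⟨R₁, hR₁, hs₁⟩ := exists_support_subset_Ioo hG.hasCompactSupport.deriv
  obtain ⟨R₂, hR₂, hs₂⟩ := exists_support_subset_Ioo hG.hasCompactSupport.deriv.deriv
  set R := max R₀ (max R₁ R₂) with hRdef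
  have hRR₀ : R₀ ≤ R := le_max_left _ _
  have hRR₁ : R₁ ≤ R := (le_max_left _ _).trans (le_max_right _ _)
  have hRR₂ : R₂ ≤ R := (le_max_right _ _).trans (le_max_right _ _)
  have z₀ : ∀ x, x ∉ Ioo (-R) R → G x = 0 := fun x hx =>
    hs₀ x fun h => hx ⟨by linarith [h.1], by linarith [h.2]⟩
  have z₁ : ∀ x, x ∉ Ioo (-R) R → deriv G x = 0 := fun x hx =>
    hs₁ x fun h => hx ⟨by linarith [h.1], by linarith [h.2]⟩
  have z₂ : ∀ x, x ∉ Ioo (-R) R → deriv (deriv G) x = 0 := fun x hx =>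
    hs₂ x fun h => hx ⟨by linarith [h.1], by linarith [h.2]⟩
  obtain ⟨a, N, hcl, hop, ha, hb, hin⟩ := exists_filling_interval (R := R) hΩ hδ0
  have hab : a ≤ a + N * δ := by
    have : 0 ≤ N * δ := by positivity
    linarith
  -- Each end of the interval is either a boundary point of `Ω` or outside the supports, so the
  -- energy identity has no boundary term.
  have ha' : deriv G a = 0 := by
    rcases ha with h | h
    · exact hG.deriv_eq_zero a h
    · exact z₁ a fun h' => by linarith [h'.1]
  have hb' : deriv G (a + N * δ) = 0 := by
    rcases hb with h | h
    · exact hG.deriv_eq_zero _ h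
    · exact z₁ _ fun h' => by linarith [h'.2]
  have toI : ∀ h : ℝ → ℝ, (∀ x, x ∉ Ioo (-R) R → h x = 0) →
      ∫ x in (Ω : Set ℝ), h x = ∫ x in a..a + N * δ, h x := fun h hh => by
    rw [intervalIntegral.integral_of_le hab, integral_Ioc_eq_integral_Ioo]
    refine setIntegral_eq_of_subset_of_forall_sdiff_eq_zero Ω.isOpen.measurableSet hop
      fun x hx => hh x fun hxR => hx.2 (hin x hx.1 hxR)
  rw [norm_eq_sqrt_integral hgG,
    norm_eq_sqrt_integral (operatorCore_sub_smul_ae_eq hG hgG ν k s),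
    toI _ fun x hx => by rw [z₀ x hx]; simp,
    toI _ fun x hx => by rw [z₀ x hx, z₂ x hx]; simp]
  have hη : 0 < |k| * (c * δ ^ m) := by positivity
  refine interval_estimate (G₁ := deriv G) (G₂ := deriv (deriv G)) (W := fun x => k * v x - s)
    (l := l) (δ := δ) (η := |k| * (c * δ ^ m))
    (fun x => (hG.contDiff.differentiable (by simp) x).hasDerivAt)
    (fun x => (hG.contDiff_deriv.differentiable (by simp) x).hasDerivAt)
    hG.contDiff_deriv_deriv.continuous N hl hδ0 hν hη hr
    ((continuousOn_const.mul (hv.mono hcl)).sub continuousOn_const) ?_ ha' hb' ?_ ?_ hr2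
  · intro t ht1 ht2
    -- Since `k v - s = k (v - s / k)`, the geometry is used at level `s / k`; a negative `k`
    -- exchanges the two signs.
    obtain ⟨p, p1, p2, p3⟩ := hgeom t δ (s / k) hδ0 hδ1
      ((Icc_subset_Icc ht1 ht2).trans hcl)
    refine ⟨p, p1, p2, ?_⟩
    have hW : ∀ x, k * v x - s = k * (v x - s / k) := fun x => by field_simp
    simp_rw [hW]
    rcases hk.lt_or_gt with hneg | hpos
    · rw [abs_of_neg hneg]
      rcases p3 with p3 | p3
      · exact Or.inr fun x hx => by nlinarith [p3 x hx]
      · exact Or.inl fun x hx => by nlinarith [p3 x hx]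
    · rw [abs_of_pos hpos]
      rcases p3 with p3 | p3
      · exact Or.inl fun x hx => by nlinarith [p3 x hx]
      · exact Or.inr fun x hx => by nlinarith [p3 x hx]
  · have h1 : 3 / (l * (|k| * (c * δ ^ m))) * r ≤ 3 / (l * c) := by
      rw [div_mul_eq_mul_div, div_le_div_iff₀ (by positivity) (by positivity)]
      have := mul_le_mul_of_nonneg_left hr1 (by positivity : 0 ≤ 3 * (l * c))
      linarith
    have h2 : 0 < 12 / (l ^ 2 * c) := by positivity
    linarith
  -- The mixed coefficient produces the second summand `12 / (l ^ 2 * c)` of `K`; the first summand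
  -- served the preceding condition.
  · have e : 3 / (l * (|k| * (c * δ ^ m))) * (4 * ν / (l * δ)) =
        12 / (l ^ 2 * c) * (ν / (|k| * δ ^ (m + 1))) := by
      rw [pow_succ]
      field_simp
      ring
    have h1 : 12 / (l ^ 2 * c) ≤ K := by
      have : 0 < 3 / (l * c) := by positivity
      linarith
    have h2 : (ν / (|k| * δ ^ (m + 1))) ^ 2 * r ≤ ν := by
      rw [div_pow, div_mul_eq_mul_div, div_le_iff₀ (by positivity)]
      nlinarith
    rw [e, mul_pow, mul_assoc]
    have h0 : 0 < 12 / (l ^ 2 * c) := by positivity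
    gcongr

end Resolvent

end ShearFlow

end

theorem mainTheorem3 (m : ℕ) (hm : 1 ≤ m) (Ω : TopologicalSpace.Opens ℝ)
    (hΩ : (Ω : Set ℝ) = Set.univ ∨ (∃ L₁ : ℝ, (Ω : Set ℝ) = Set.Iio L₁) ∨
      ∃ L₂ : ℝ, (Ω : Set ℝ) = Set.Ioi L₂)
    (v : ℝ → ℝ) (hv : ContDiffOn ℝ m v (closure (Ω : Set ℝ)))
    (hnondeg : ∀ y ∈ closure (Ω : Set ℝ),
      0 < ∑ j ∈ Finset.Icc 1 m, |iteratedDerivWithin j v (closure (Ω : Set ℝ)) y|)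
    (hinfty : ∃ c₀ : ℝ, 0 < c₀ ∧ ENNReal.ofReal c₀ ≤
      Filter.liminf (fun y => ENNReal.ofReal |derivWithin v (closure (Ω : Set ℝ)) y|)
        (Filter.cocompact ℝ ⊓ Filter.principal (closure (Ω : Set ℝ)))) :
    ∃ C : ℝ, 0 < C ∧ ∀ ν k : ℝ, 0 < ν → k ≠ 0 →
      ENNReal.ofReal (C * ShearFlow.rate m ν k) ≤
        ShearFlow.pseudospectralAbscissa (ShearFlow.H Ω v ν k) := by
  obtain ⟨c₀, hc₀, hinf⟩ := hinfty
  have hΩ' := ShearFlow.eq_univ_or_isHalfLine hΩ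
  obtain ⟨l, c, hl, hc, hgeom⟩ := ShearFlow.exists_proportional_subinterval hm
    (ShearFlow.uniqueDiffOn_closure hΩ') isClosed_closure hv hnondeg hc₀ hinf
  -- `K` involves only the geometric constants `l` and `c`, so the final constant `M⁻¹` is
  -- independent of `ν`, `k` and `s`.
  set K : ℝ := 3 / (l * c) + 12 / (l ^ 2 * c) with hK
  have hK0 : 0 < K := by positivity
  set M : ℝ := 2 * K + K ^ 2 + 4 with hM
  have hM0 : 0 < M := by positivity
  refine ⟨M⁻¹, by positivity, fun ν k hν hk => ?_⟩
  have hr := ShearFlow.rate_pos m hν hk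
  refine ShearFlow.le_pseudospectralAbscissa (by positivity) fun s => ?_
  refine ShearFlow.exists_isResolvent_closure
    (ShearFlow.isClosable_operatorCore hΩ' hv.continuousOn ν k) (by positivity)
    (ShearFlow.neumannTests Ω v) (fun g hg => ?_)
    (ShearFlow.topologicalClosure_map_neumannTests hΩ' hv.continuousOn k s hν)
    (ShearFlow.eq_zero_of_closure_eigenvector hΩ' hv.continuousOn hν)
  have h := ShearFlow.rate_mul_norm_le hΩ' hv.continuousOn hl hc hgeom s hν hk hK hg
  rw [mul_assoc, inv_mul_le_iff₀ hM0]
  exact h
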